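/- Let $m\ge 4$ and let $$F_{m,1}=\{\Delta+\Gamma\Gamma^t : \Delta\in\mathbb{R}^{m\times m}\text{ diagonal and positive definite},\ \Gamma\in\mathbb{R}^{m}\}$$ be the set of covariance matrices of the one-factor analysis model. Identify the space of symmetric $m\times m$ matrices with $\mathbb{R}^{\binom{m+1}{2}}$ through the entries with index $ij$, $i\le j$, and let $I(\Sigma)$ be the Fisher information matrix at $\Sigma$, in these coordinates, of the model of all centered normal distributions $\mathcal{N}_m(0,\Sigma)$ with $\Sigma$ positive definite. For a set $\Theta\subseteq\mathbb{R}^k$ and $\theta\in\Theta$, the algebraic tangent cone is $$A_\Theta(\theta)=\{\tau\in\mathbb{R}^k : f_{\theta,\min}(\tau)=0\text{ for all } f\in\mathbb{R}[t_1,\dots,t_k]\text{ that vanish on }\Theta\},$$ where $f_{\theta,\min}$ is the nonzero homogeneous component of smallest degree of the polynomial $f_\theta(t)=f(t+\theta)$ (and $f_{\theta,\min}=0$ if $f=0$). **Theorem 6.3.** Let $\Sigma_0=(\sigma_{gh})\in F_{m,1}$ have exactly one nonzero off-diagonal entry $\sigma_{ij}$ with $i<j$, and let $Z\sim\mathcal{N}_{\binom{m+1}{2}}(0,I(\Sigma_0)^{-1})$.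 Then the squared Mahalanobis distance $$\min_{\Sigma\in A_{F_{m,1}}(\Sigma_0)}(Z-\Sigma)^t I(\Sigma_0)(Z-\Sigma),$$ in which the minimum is attained, has the distribution of $V+W$, where $V$ and $W$ are independent, $V$ has the chi-square distribution with $\binom{m-2}{2}$ degrees of freedom, and $W$ is distributed like the smaller of the two eigenvalues of a $2\times2$ Wishart matrix with $m-2$ degrees of freedom and scale parameter the identity matrix. -/

import Mathlib

open MeasureTheory ProbabilityTheory

noncomputable section

/-! ### Algebraic tangent cones -/

section AlgebraicTangentCone

variable {κ : Type*}

/-- The polynomial `f_θ`, obtained from `f` by substituting `t_i + θ_i` for each `t_i`. -/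
def shiftPoly (θ : κ → ℝ) (f : MvPolynomial κ ℝ) : MvPolynomial κ ℝ :=
  MvPolynomial.aeval (fun i => MvPolynomial.X i + MvPolynomial.C (θ i)) f

/-- The nonzero homogeneous component of smallest degree of `g` (and `0` if `g = 0`). -/
def initialForm (g : MvPolynomial κ ℝ) : MvPolynomial κ ℝ :=
  MvPolynomial.homogeneousComponent
    (sInf {h : ℕ | MvPolynomial.homogeneousComponent h g ≠ 0}) g

/-- The algebraic tangent cone of `Θ` at `θ`: the common zeros of the lowest-degree forms
of all `f_θ`, where `f` runs over all polynomials that vanish on `Θ`. -/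
def algebraicTangentCone (Θ : Set (κ → ℝ)) (θ : κ → ℝ) : Set (κ → ℝ) :=
  {τ | ∀ f ∈ MvPolynomial.vanishingIdeal ℝ Θ,
    MvPolynomial.eval τ (initialForm (shiftPoly θ f)) = 0}

end AlgebraicTangentCone

/-! ### Coordinates on the space of symmetric matrices -/

/-- Ordered pairs `ij` with `i ≤ j`. -/
abbrev SymIdx (m : ℕ) : Type := {p : Fin m × Fin m // p.1 ≤ p.2}

/-- The upper triangular entries of a (symmetric) matrix. -/
def symCoords {m : ℕ} (S : Matrix (Fin m) (Fin m) ℝ) : SymIdx m → ℝ :=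
  fun p => S p.1.1 p.1.2

/-- The symmetric matrix with the given upper triangular entries. -/
def symMatrix {m : ℕ} (θ : SymIdx m → ℝ) : Matrix (Fin m) (Fin m) ℝ :=
  Matrix.of fun i j => θ ⟨(min i j, max i j), min_le_max⟩

/-! ### The factor analysis model -/

/-- The covariance matrices `Δ + Γ Γᵗ` with `Δ` a positive definite diagonal matrix and `Γ` a
real `m × l` matrix. -/
def factorModel (m l : ℕ) : Set (Matrix (Fin m) (Fin m) ℝ) :=
  {S | ∃ (δ : Fin m → ℝ) (Γ : Matrix (Fin m) (Fin l) ℝ),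
    (∀ i, 0 < δ i) ∧ S = Matrix.diagonal δ + Γ * Γ.transpose}

/-! ### Fisher information of the centered normal model -/

/-- The Lebesgue density of the normal distribution `N(0, S)`, for positive definite `S`. -/
def normalDensity {m : ℕ} (S : Matrix (Fin m) (Fin m) ℝ) (x : Fin m → ℝ) : ℝ :=
  (Real.sqrt ((2 * Real.pi) ^ m * S.det))⁻¹ *
    Real.exp (-(dotProduct x (S⁻¹.mulVec x)) / 2)

/-- The score: the partial derivative, with respect to the coordinate `a`, of the log-density of
`N(0, S)`, where `S` is parametrized by its upper triangular entries. -/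
def normalScore {m : ℕ} (S : Matrix (Fin m) (Fin m) ℝ) (a : SymIdx m) (x : Fin m → ℝ) : ℝ :=
  deriv (fun t : ℝ =>
    Real.log (normalDensity (symMatrix (symCoords S + t • Pi.single a (1 : ℝ))) x)) 0

/-- The Fisher information matrix at `S` of the model of all centered normal distributions:
the expected outer product of the score under `N(0, S)`. -/
def fisherInformation {m : ℕ} (S : Matrix (Fin m) (Fin m) ℝ) :
    Matrix (SymIdx m) (SymIdx m) ℝ :=
  Matrix.of fun a b =>
    ∫ x : EuclideanSpace ℝ (Fin m), normalScore S a x.ofLp * normalScore S b x.ofLp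
      ∂(multivariateGaussian 0 S)

/-! ### Mahalanobis distance -/

/-- The quadratic form `(z - τ)ᵗ J (z - τ)`. -/
def mahalanobisForm {κ : Type*} [Fintype κ] (J : Matrix κ κ ℝ) (z τ : κ → ℝ) : ℝ :=
  dotProduct (z - τ) (J.mulVec (z - τ))

/-- The squared Mahalanobis distance from `z` to the set `A`. -/
def mahalanobisDistSq {κ : Type*} [Fintype κ] (J : Matrix κ κ ℝ) (A : Set (κ → ℝ))
    (z : κ → ℝ) : ℝ :=
  sInf (mahalanobisForm J z '' A)

/-! ### Chi-square and Wishart distributions -/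

/-- The chi-square distribution with `k` degrees of freedom: the law of the sum of squares of
`k` independent standard normal random variables. -/
def chiSquareLaw (k : ℕ) : Measure ℝ :=
  (Measure.pi fun _ : Fin k => gaussianReal 0 1).map fun x => ∑ i, x i ^ 2

instance matrixMeasurableSpace {ι κ : Type*} : MeasurableSpace (Matrix ι κ ℝ) :=
  inferInstanceAs (MeasurableSpace (ι → κ → ℝ))

/-- The `p × p` Wishart distribution with `n` degrees of freedom and scale parameter `S`: the law
of `∑ xₖ xₖᵗ` for independent `x₁, …, xₙ` with distribution `N(0, S)`. -/
def wishartLaw (p n : ℕ) (S : Matrix (Fin p) (Fin p) ℝ) : Measure (Matrix (Fin p) (Fin p) ℝ) :=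
  (Measure.pi fun _ : Fin n => multivariateGaussian (0 : EuclideanSpace ℝ (Fin p)) S).map
    fun x => ∑ k, Matrix.vecMulVec (x k).ofLp (x k).ofLp

/-- The smallest eigenvalue of a (symmetric) real matrix. -/
def smallestEigenvalue {p : ℕ} (M : Matrix (Fin p) (Fin p) ℝ) : ℝ :=
  sInf {c : ℝ | Module.End.HasEigenvalue (Matrix.toLin' M) c}

end

open Filter Topology
open scoped Matrix MatrixOrder

/-! ### Initial forms and curves through the base point. -/

section InitialForms

variable {κ : Type*}

/-! The proof computes the tangent cone explicitly, finds linear coordinates in which the Fisher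
metric is Euclidean and the cone keeps its shape, and then solves two decoupled minimization
problems.

Cone. Off-diagonal entries of a one-factor matrix are products `γ_a γ_b`, so tetrads vanish on the
model. For `k, l` outside `{i, j}`, the tetrad `σ_ij σ_kl - σ_ik σ_jl` shifted to the base point has
initial form `S_ij t_kl`, while `σ_ik σ_jl - σ_il σ_jk` is its own initial form. Hence on the cone
`t_kl = 0` for `k ≠ l` outside `{i, j}`, and the block with rows `i, j` and the other `m - 2`
columns has rank at most one. Conversely, each such matrix is the direction of a curve in the
Zariski closure of the model (`mem_algebraicTangentCone_iff`).

Metric. The Fisher quadratic form at `S` is `tr(S⁻¹ X S⁻¹ X) / 2`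
(`dotProduct_fisherInformation_mulVec`). If `L S Lᵀ = 1`, this is half the squared Frobenius norm of
`L X Lᵀ`, so the scaled entries of `L Z Lᵀ` are independent standard normals
(`map_whiten_multivariateGaussian`). As `S` has one off-diagonal entry, `L` can be taken diagonal
except at position `j i`; such an `L` preserves the equations of the cone
(`mem_algebraicTangentCone_iff_whiten`).

Distance. The `(m-2).choose 2` entries forced to vanish contribute their sum of squares. The `2 ×
(m-2)` block contributes its squared distance to the arrays of rank at most one, which is the
smallest eigenvalue of its Gram matrix. The remaining coordinates are free and contribute nothing.
The two blocks use disjoint Gaussian coordinates, which gives independence and both laws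
(`identDistrib_coneDistSq`). -/

theorem eval_shiftPoly (θ τ : κ → ℝ) (f : MvPolynomial κ ℝ) :
    MvPolynomial.eval τ (shiftPoly θ f) = MvPolynomial.eval (τ + θ) f := by
  unfold shiftPoly
  induction f using MvPolynomial.induction_on with
  | C a => simp
  | add p q hp hq => rw [map_add, map_add, map_add, hp, hq]
  | mul_X p n hp => rw [map_mul, map_mul, map_mul, hp]; simp

theorem initialForm_eq_of_homogeneousComponent {g h : MvPolynomial κ ℝ} {n : ℕ}
    (hn : MvPolynomial.homogeneousComponent n g = h) (h0 : h ≠ 0)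
    (hlt : ∀ k < n, MvPolynomial.homogeneousComponent k g = 0) : initialForm g = h := by
  have : sInf {h : ℕ | MvPolynomial.homogeneousComponent h g ≠ 0} = n := by
    apply le_antisymm
    · exact Nat.sInf_le (by simp [hn, h0])
    · refine le_csInf ⟨n, by simp [hn, h0]⟩ fun k hk => ?_
      by_contra hc
      exact hk (hlt k (not_le.mp hc))
  rw [initialForm, this, hn]

theorem initialForm_add_of_isHomogeneous {h r : MvPolynomial κ ℝ} {n k : ℕ}
    (hh : h.IsHomogeneous n) (hr : r.IsHomogeneous k) (hnk : n < k) (h0 : h ≠ 0) :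
    initialForm (h + r) = h := by
  have key : ∀ l, MvPolynomial.homogeneousComponent l (h + r)
      = (if n = l then h else 0) + if k = l then r else 0 := by
    intro l
    rw [map_add, MvPolynomial.homogeneousComponent_of_mem hh,
      MvPolynomial.homogeneousComponent_of_mem hr]
    simp only [eq_comm]
  refine initialForm_eq_of_homogeneousComponent (n := n) ?_ h0 fun l hl => ?_
  · rw [key, if_pos rfl, if_neg (by omega), add_zero]
  · rw [key, if_neg (by omega), if_neg (by omega), add_zero]

theorem initialForm_of_isHomogeneous {h : MvPolynomial κ ℝ} {n : ℕ}
    (hh : h.IsHomogeneous n) (h0 : h ≠ 0) : initialForm h = h := by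
  simpa using initialForm_add_of_isHomogeneous hh
    (MvPolynomial.isHomogeneous_zero κ ℝ (n + 1)) (Nat.lt_succ_self n) h0

theorem isHomogeneous_eval_smul {h : MvPolynomial κ ℝ} {n : ℕ} (hh : h.IsHomogeneous n)
    (t : ℝ) (w : κ → ℝ) :
    MvPolynomial.eval (t • w) h = t ^ n * MvPolynomial.eval w h := by
  rw [MvPolynomial.eval_eq, MvPolynomial.eval_eq, Finset.mul_sum]
  refine Finset.sum_congr rfl fun d hd => ?_
  have := hh.degree_eq_sum_deg_support hd
  simp only [Pi.smul_apply, smul_eq_mul, mul_pow, Finset.prod_mul_distrib]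
  rw [Finset.prod_pow_eq_pow_sum, ← this]
  ring

/-- If `g` vanishes along a curve leaving the origin in direction `τ`, then its initial form
vanishes at `τ`. -/
theorem eval_initialForm_eq_zero_of_tendsto {g : MvPolynomial κ ℝ} {τ : κ → ℝ} {w : ℝ → κ → ℝ}
    (hw : Tendsto w (𝓝[>] 0) (𝓝 τ))
    (hg : ∀ᶠ t in 𝓝[>] (0 : ℝ), MvPolynomial.eval (t • w t) g = 0) :
    MvPolynomial.eval τ (initialForm g) = 0 := by
  set d := sInf {h : ℕ | MvPolynomial.homogeneousComponent h g ≠ 0} with hd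
  have hlt : ∀ k < d, MvPolynomial.homogeneousComponent k g = 0 := by
    intro k hk
    by_contra hc
    exact absurd (Nat.sInf_le (s := {h : ℕ | MvPolynomial.homogeneousComponent h g ≠ 0}) hc)
      (not_le.mpr hk)
  -- `F t` is `t⁻ᵈ` times the value of `g` at `t • w t`. The truncated `k - d` is harmless because
  -- components of degree below `d` vanish; as `t → 0` only `k = d` survives, through `0 ^ 0 = 1`.
  let F : ℝ → ℝ := fun t => ∑ k ∈ Finset.range (g.totalDegree + 1),
    t ^ (k - d) * MvPolynomial.eval (w t) (MvPolynomial.homogeneousComponent k g)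
  have hF0 : ∀ᶠ t in 𝓝[>] (0 : ℝ), F t = 0 := by
    filter_upwards [hg, self_mem_nhdsWithin] with t ht htpos
    have htpos : 0 < t := htpos
    have : t ^ d * F t = 0 := by
      rw [← ht]
      conv_rhs => rw [← MvPolynomial.sum_homogeneousComponent g]
      rw [map_sum, Finset.mul_sum]
      refine Finset.sum_congr rfl fun k _ => ?_
      rw [isHomogeneous_eval_smul (MvPolynomial.homogeneousComponent_isHomogeneous k g)]
      rcases lt_or_ge k d with h | h
      · simp [hlt k h]
      · rw [← mul_assoc, ← pow_add, Nat.add_sub_cancel' h]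
    exact (mul_eq_zero.mp this).resolve_left (pow_pos htpos d).ne'
  have hFlim : Tendsto F (𝓝[>] 0) (𝓝 (∑ k ∈ Finset.range (g.totalDegree + 1),
      (0 : ℝ) ^ (k - d) * MvPolynomial.eval τ (MvPolynomial.homogeneousComponent k g))) := by
    refine tendsto_finsetSum _ fun k _ => Tendsto.mul ?_ ?_
    · exact ((continuous_pow (k - d)).tendsto (0 : ℝ)).mono_left nhdsWithin_le_nhds
    · exact ((MvPolynomial.continuous_eval _).tendsto τ).comp hw
  have hlim : (∑ k ∈ Finset.range (g.totalDegree + 1),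
      (0 : ℝ) ^ (k - d) * MvPolynomial.eval τ (MvPolynomial.homogeneousComponent k g)) = 0 :=
    tendsto_nhds_unique (hFlim.congr' hF0) tendsto_const_nhds
  have hsum : (∑ k ∈ Finset.range (g.totalDegree + 1),
      (0 : ℝ) ^ (k - d) * MvPolynomial.eval τ (MvPolynomial.homogeneousComponent k g))
      = MvPolynomial.eval τ (MvPolynomial.homogeneousComponent d g) := by
    rw [Finset.sum_eq_single d]
    · simp
    · intro k _ hk
      rcases lt_or_gt_of_ne hk with h | h
      · simp [hlt k h]
      · rw [zero_pow (by omega), zero_mul]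
    · intro h
      rw [MvPolynomial.homogeneousComponent_eq_zero _ _ (by simpa [Nat.lt_succ_iff] using h)]
      simp
  rw [initialForm, ← hd, ← hsum, hlim]

/-- The points `θ + t w_t` need not lie in `Θ`: only polynomial equations are tested, so a curve in
the Zariski closure suffices. -/
theorem mem_algebraicTangentCone_of_tendsto {Θ : Set (κ → ℝ)} {θ τ : κ → ℝ} {w : ℝ → κ → ℝ}
    (hw : Tendsto w (𝓝[>] 0) (𝓝 τ))
    (hz : ∀ f ∈ MvPolynomial.vanishingIdeal ℝ Θ, ∀ᶠ t in 𝓝[>] (0 : ℝ),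
      MvPolynomial.eval (t • w t + θ) f = 0) :
    τ ∈ algebraicTangentCone Θ θ := by
  intro f hf
  refine eval_initialForm_eq_zero_of_tendsto hw ?_
  filter_upwards [hz f hf] with t ht
  rw [eval_shiftPoly, ht]

/-- A polynomial that vanishes far out on a ray vanishes on the whole line. -/
theorem eval_eq_zero_of_eventually_eval_add_smul {f : MvPolynomial κ ℝ} {θ η : κ → ℝ}
    (h : ∀ᶠ r : ℝ in atTop, MvPolynomial.eval (θ + r • η) f = 0) :
    MvPolynomial.eval θ f = 0 := by
  let q : Polynomial ℝ := MvPolynomial.aeval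
    (fun k => Polynomial.C (θ k) + Polynomial.X * Polynomial.C (η k)) f
  have hq : ∀ r, q.eval r = MvPolynomial.eval (θ + r • η) f := by
    intro r
    simp only [q]
    clear h q
    induction f using MvPolynomial.induction_on with
    | C a => simp
    | add p q hp hq => rw [map_add, map_add, Polynomial.eval_add, hp, hq]
    | mul_X p n hp => rw [map_mul, map_mul, Polynomial.eval_mul, hp]; simp [mul_comm (η n)]
  have hq0 : q = 0 := by
    obtain ⟨R, hR⟩ := eventually_atTop.mp h
    refine Polynomial.eq_zero_of_infinite_isRoot q ((Set.Ici_infinite R).mono fun r hr => ?_)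
    exact (hq r).trans (hR r hr)
  have := hq 0
  rw [hq0] at this
  simpa using this.symm

end InitialForms

/-! ### Tetrads and the equations they impose on the tangent cone. -/

section FactorAnalysisCone

variable {m : ℕ}

/-- The index of the entry `a b` (equivalently `b a`) of a symmetric matrix. -/
def symIdx (a b : Fin m) : SymIdx m := ⟨(min a b, max a b), min_le_max⟩

theorem symMatrix_apply (θ : SymIdx m → ℝ) (a b : Fin m) : symMatrix θ a b = θ (symIdx a b) := rfl

theorem symIdx_comm (a b : Fin m) : symIdx a b = symIdx b a := by
  simp only [symIdx, min_comm, max_comm]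

theorem symMatrix_isSymm (θ : SymIdx m → ℝ) : (symMatrix θ).IsSymm := by
  ext a b
  rw [Matrix.transpose_apply, symMatrix_apply, symMatrix_apply, symIdx_comm]

theorem symIdx_of_le {a b : Fin m} (h : a ≤ b) : symIdx a b = ⟨(a, b), h⟩ := by
  simp [symIdx, h]

theorem symCoords_symIdx {S : Matrix (Fin m) (Fin m) ℝ} (hS : S.IsSymm) (a b : Fin m) :
    symCoords S (symIdx a b) = S a b := by
  rcases le_total a b with h | h
  · rw [symIdx_of_le h]; rfl
  · rw [symIdx_comm, symIdx_of_le h]; exact hS.apply a b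

theorem symMatrix_symCoords {S : Matrix (Fin m) (Fin m) ℝ} (hS : S.IsSymm) :
    symMatrix (symCoords S) = S := by
  ext a b
  rw [symMatrix_apply, symCoords_symIdx hS]

theorem symIdx_eq_iff {a b c d : Fin m} :
    symIdx a b = symIdx c d ↔ (a = c ∧ b = d) ∨ (a = d ∧ b = c) := by
  constructor
  · intro h
    have h1 : min a b = min c d := congrArg (fun p => p.1.1) h
    have h2 : max a b = max c d := congrArg (fun p => p.1.2) h
    rcases le_total a b with h3 | h3 <;> rcases le_total c d with h4 | h4 <;>
      simp_all
  · rintro (⟨rfl, rfl⟩ | ⟨rfl, rfl⟩)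
    · rfl
    · exact symIdx_comm _ _

theorem isSymm_of_mem_factorModel {l : ℕ} {S : Matrix (Fin m) (Fin m) ℝ}
    (hS : S ∈ factorModel m l) : S.IsSymm := by
  obtain ⟨δ, Γ, -, rfl⟩ := hS
  refine (Matrix.isSymm_diagonal δ).add ?_
  rw [Matrix.IsSymm, Matrix.transpose_mul, Matrix.transpose_transpose]

theorem exists_apply_eq_mul_of_mem_factorModel_one {S : Matrix (Fin m) (Fin m) ℝ}
    (hS : S ∈ factorModel m 1) : ∃ γ : Fin m → ℝ, ∀ a b, a ≠ b → S a b = γ a * γ b := by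
  obtain ⟨δ, Γ, -, rfl⟩ := hS
  refine ⟨fun a => Γ a 0, fun a b hab => ?_⟩
  simp [Matrix.diagonal_apply_ne _ hab, Matrix.mul_apply]

theorem diagonal_add_smul_vecMulVec_mem_factorModel {δ γ : Fin m → ℝ} {p : ℝ}
    (hδ : ∀ a, 0 < δ a) (hp : 0 ≤ p) :
    Matrix.diagonal δ + p • Matrix.vecMulVec γ γ ∈ factorModel m 1 := by
  refine ⟨δ, Matrix.of fun a _ => √p * γ a, hδ, ?_⟩
  ext a b
  simp only [Matrix.add_apply, Matrix.smul_apply, Matrix.vecMulVec_apply, Matrix.mul_apply,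
    Matrix.transpose_apply, Matrix.of_apply, smul_eq_mul, Finset.sum_const, Finset.card_univ,
    Fintype.card_fin, one_smul]
  linear_combination (-(γ a * γ b)) * Real.mul_self_sqrt hp

/-- The Zariski closure of the one-factor model contains all matrices `D + p γ γᵗ`, with `D`
diagonal and `p` real of arbitrary signs. -/
theorem eval_symCoords_diagonal_add_smul_vecMulVec {f : MvPolynomial (SymIdx m) ℝ}
    (hf : f ∈ MvPolynomial.vanishingIdeal ℝ (symCoords '' factorModel m 1))
    (δ γ : Fin m → ℝ) (p : ℝ) :
    MvPolynomial.eval (symCoords (Matrix.diagonal δ + p • Matrix.vecMulVec γ γ)) f = 0 := by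
  -- Adding `r (1 + γ γᵗ)` replaces `δ` by `δ + r` and `p` by `p + r`, so the ray enters the model
  -- for large `r`.
  refine eval_eq_zero_of_eventually_eval_add_smul
    (η := symCoords (Matrix.diagonal 1 + Matrix.vecMulVec γ γ)) ?_
  have h1 : ∀ᶠ r : ℝ in atTop, ∀ a, 0 < δ a + r := by
    rw [eventually_all]
    intro a
    filter_upwards [eventually_gt_atTop (-δ a)] with r hr
    linarith
  filter_upwards [h1, eventually_ge_atTop (-p)] with r hr hp
  rw [MvPolynomial.mem_vanishingIdeal_iff] at hf
  have := hf _ ⟨_, diagonal_add_smul_vecMulVec_mem_factorModel (γ := γ) (p := p + r) hr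
    (by linarith), rfl⟩
  rw [MvPolynomial.aeval_def, MvPolynomial.eval₂_eq_eval_map] at this
  simp only [Algebra.algebraMap_self, MvPolynomial.map_id] at this
  convert this using 2
  congr 1
  funext q
  obtain ⟨⟨a, b⟩, h⟩ := q
  rcases eq_or_ne a b with rfl | hab
  · simp [symCoords, Matrix.vecMulVec_apply]; ring
  · simp [symCoords, Matrix.vecMulVec_apply, hab]; ring

/-- The tetrad `σ_ij σ_kl - σ_ik σ_jl`. -/
noncomputable def tetrad (i j k l : Fin m) : MvPolynomial (SymIdx m) ℝ :=
  MvPolynomial.X (symIdx i j) * MvPolynomial.X (symIdx k l)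
    - MvPolynomial.X (symIdx i k) * MvPolynomial.X (symIdx j l)

theorem tetrad_mem_vanishingIdeal {i j k l : Fin m} (hij : i ≠ j) (hkl : k ≠ l) (hik : i ≠ k)
    (hjl : j ≠ l) :
    tetrad i j k l ∈ MvPolynomial.vanishingIdeal ℝ (symCoords '' factorModel m 1) := by
  rw [MvPolynomial.mem_vanishingIdeal_iff]
  rintro _ ⟨S, hS, rfl⟩
  have hs := isSymm_of_mem_factorModel hS
  obtain ⟨γ, hγ⟩ := exists_apply_eq_mul_of_mem_factorModel_one hS
  simp only [tetrad, map_sub, map_mul, MvPolynomial.aeval_X, symCoords_symIdx hs,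
    hγ _ _ hij, hγ _ _ hkl, hγ _ _ hik, hγ _ _ hjl]
  ring

theorem shiftPoly_tetrad (S : Matrix (Fin m) (Fin m) ℝ) (hS : S.IsSymm) (i j k l : Fin m) :
    shiftPoly (symCoords S) (tetrad i j k l) =
      (MvPolynomial.X (symIdx i j) + MvPolynomial.C (S i j)) *
        (MvPolynomial.X (symIdx k l) + MvPolynomial.C (S k l))
      - (MvPolynomial.X (symIdx i k) + MvPolynomial.C (S i k)) *
        (MvPolynomial.X (symIdx j l) + MvPolynomial.C (S j l)) := by
  rw [shiftPoly, tetrad]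
  rw [map_sub, map_mul, map_mul]
  simp only [MvPolynomial.aeval_X, symCoords_symIdx hS]

theorem tetrad_isHomogeneous (i j k l : Fin m) : (tetrad i j k l).IsHomogeneous 2 :=
  ((MvPolynomial.isHomogeneous_X ℝ _).mul (MvPolynomial.isHomogeneous_X ℝ _)).sub
    ((MvPolynomial.isHomogeneous_X ℝ _).mul (MvPolynomial.isHomogeneous_X ℝ _))

variable {S : Matrix (Fin m) (Fin m) ℝ} {i j : Fin m} {τ : SymIdx m → ℝ}

/-- In the tetrad `σ_ij σ_kl - σ_ik σ_jl` only the factor `σ_ij` is nonzero at the base point, so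
the shifted tetrad is the linear form `S_ij t_kl` plus a quadratic one. -/
theorem apply_eq_zero_of_mem_algebraicTangentCone (hS : S.IsSymm) (hij : i ≠ j)
    (hs : S i j ≠ 0) (h0 : ∀ a b, a ≠ b → b ≠ i → b ≠ j → S a b = 0)
    (hτ : τ ∈ algebraicTangentCone (symCoords '' factorModel m 1) (symCoords S))
    {k l : Fin m} (hki : k ≠ i) (hkj : k ≠ j) (hli : l ≠ i) (hlj : l ≠ j) (hkl : k ≠ l) :
    symMatrix τ k l = 0 := by
  have h := hτ _ (tetrad_mem_vanishingIdeal (i := i) (j := j) (k := k) (l := l) hij hkl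
    hki.symm hlj.symm)
  have h2 : (MvPolynomial.C (S i j) * MvPolynomial.X (symIdx k l) :
      MvPolynomial (SymIdx m) ℝ) ≠ 0 :=
    mul_ne_zero (by simpa using hs) (MvPolynomial.X_ne_zero _)
  rw [shiftPoly_tetrad S hS, h0 k l hkl hli hlj, h0 i k hki.symm hki hkj,
    h0 j l hlj.symm hli hlj] at h
  have h1 : (MvPolynomial.X (symIdx i j) + MvPolynomial.C (S i j)) *
        (MvPolynomial.X (symIdx k l) + MvPolynomial.C (0 : ℝ))
      - (MvPolynomial.X (symIdx i k) + MvPolynomial.C (0 : ℝ)) *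
        (MvPolynomial.X (symIdx j l) + MvPolynomial.C (0 : ℝ))
      = MvPolynomial.C (S i j) * MvPolynomial.X (symIdx k l) + tetrad i j k l := by
    rw [tetrad, map_zero]; ring
  rw [h1, initialForm_add_of_isHomogeneous (MvPolynomial.isHomogeneous_C_mul_X _ _)
    (tetrad_isHomogeneous i j k l) one_lt_two h2] at h
  simp only [map_mul, MvPolynomial.eval_C, MvPolynomial.eval_X] at h
  exact (mul_eq_zero.mp h).resolve_left hs

/-- All four entries in this tetrad vanish at the base point, so the shift leaves it unchanged and,
being homogeneous, it is its own initial form. -/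
theorem minor_eq_zero_of_mem_algebraicTangentCone (hS : S.IsSymm) (hij : i ≠ j)
    (h0 : ∀ a b, a ≠ b → b ≠ i → b ≠ j → S a b = 0)
    (hτ : τ ∈ algebraicTangentCone (symCoords '' factorModel m 1) (symCoords S))
    {k l : Fin m} (hki : k ≠ i) (hkj : k ≠ j) (hli : l ≠ i) (hlj : l ≠ j) :
    symMatrix τ i k * symMatrix τ j l = symMatrix τ i l * symMatrix τ j k := by
  rcases eq_or_ne k l with rfl | hkl
  · rfl
  have h := hτ _ (tetrad_mem_vanishingIdeal (i := i) (j := k) (k := l) (l := j)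
    hki.symm hlj hli.symm hkj)
  have h2 : tetrad i k l j ≠ 0 := by
    intro hc
    -- At this indicator point the first monomial of the tetrad is `1` and the second is `0`.
    have := congrArg (MvPolynomial.eval fun p => if p = symIdx i k ∨ p = symIdx l j then 1 else 0)
      hc
    simp [tetrad, symIdx_eq_iff, hij, hkl, hki, hli, hkj, hlj, hij.symm, hkl.symm, hki.symm,
      hli.symm, hkj.symm, hlj.symm] at this
  have h1 : shiftPoly (symCoords S) (tetrad i k l j) = tetrad i k l j := by
    rw [shiftPoly_tetrad S hS, h0 i k hki.symm hki hkj, h0 i l hli.symm hli hlj,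
      ← hS.apply l j, ← hS.apply k j, h0 j k hkj.symm hki hkj, h0 j l hlj.symm hli hlj, tetrad]
    simp
  rw [h1, initialForm_of_isHomogeneous (tetrad_isHomogeneous _ _ _ _) h2] at h
  simp only [tetrad, map_sub, map_mul, MvPolynomial.eval_X] at h
  rw [symIdx_comm l j, symIdx_comm k j] at h
  simp only [symMatrix_apply]
  linarith

end FactorAnalysisCone

/-! ### The converse: curves realizing every direction allowed by the equations. -/

section FactorAnalysisConeConverse

variable {m : ℕ} {S : Matrix (Fin m) (Fin m) ℝ} {i j : Fin m} {τ : SymIdx m → ℝ}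

/-- A `2 × n` array with vanishing `2 × 2` minors has rank at most one. -/
theorem exists_eq_mul_of_minors_eq_zero {ι : Type*} {x y : ι → ℝ}
    (h : ∀ k l, x k * y l = x l * y k) :
    ∃ (a b : ℝ) (u : ι → ℝ), ∀ k, x k = a * u k ∧ y k = b * u k := by
  by_cases h0 : ∀ k, x k = 0 ∧ y k = 0
  · exact ⟨0, 0, 0, fun k => by simp [h0 k]⟩
  · push Not at h0
    obtain ⟨k₀, hk₀⟩ := h0
    have hpos : x k₀ ^ 2 + y k₀ ^ 2 ≠ 0 := by
      intro hc
      have h1 : x k₀ = 0 := by nlinarith [sq_nonneg (x k₀), sq_nonneg (y k₀)]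
      exact hk₀ h1 (by nlinarith [sq_nonneg (x k₀), sq_nonneg (y k₀)])
    -- `u k` is the coefficient of the orthogonal projection of column `k` onto the nonzero column
    -- `k₀`.
    refine ⟨x k₀, y k₀, fun k => (x k₀ * x k + y k₀ * y k) / (x k₀ ^ 2 + y k₀ ^ 2),
      fun k => ⟨?_, ?_⟩⟩
    · field_simp
      linear_combination (-(y k₀)) * h k₀ k
    · field_simp
      linear_combination (x k₀) * h k₀ k

-- Write the block of `τ` as `(a u, b u)`. The curve `M t = D + p γ γᵗ` stays in the Zariski closure
-- of the model, where the signs of `p` and `D` do not matter, and its difference quotient at `S`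
-- tends to `τ`.
set_option maxHeartbeats 1000000 in
theorem mem_algebraicTangentCone_of_minors (hS : S.IsSymm) (hij : i ≠ j)
    (hs : S i j ≠ 0) (h0 : ∀ a b, a ≠ b → b ≠ i → b ≠ j → S a b = 0)
    (h1 : ∀ k l, k ≠ i → k ≠ j → l ≠ i → l ≠ j → k ≠ l → symMatrix τ k l = 0)
    (h2 : ∀ k l, k ≠ i → k ≠ j → l ≠ i → l ≠ j →
      symMatrix τ i k * symMatrix τ j l = symMatrix τ i l * symMatrix τ j k) :
    τ ∈ algebraicTangentCone (symCoords '' factorModel m 1) (symCoords S) := by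
  obtain ⟨a, b, u, hu⟩ := exists_eq_mul_of_minors_eq_zero (ι := {k : Fin m // k ≠ i ∧ k ≠ j})
    (x := fun k => symMatrix τ i k) (y := fun k => symMatrix τ j k)
    (fun k l => h2 k l k.2.1 k.2.2 l.2.1 l.2.2)
  let u' : Fin m → ℝ := fun k => if h : k ≠ i ∧ k ≠ j then u ⟨k, h⟩ else 0
  have hui : ∀ k, k ≠ i → k ≠ j → symMatrix τ i k = a * u' k := by
    intro k h h'
    simp only [u', ne_eq, h, not_false_eq_true, h', and_self, dif_pos]
    exact (hu ⟨k, h, h'⟩).1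
  have huj : ∀ k, k ≠ i → k ≠ j → symMatrix τ j k = b * u' k := by
    intro k h h'
    simp only [u', ne_eq, h, not_false_eq_true, h', and_self, dif_pos]
    exact (hu ⟨k, h, h'⟩).2
  let s : ℝ → ℝ := fun t => S i j + t * symMatrix τ i j
  -- Replacing `a, b` by `a + t, b + t` keeps them nonzero for small `t > 0`. The choice of `p` and
  -- `γ` gives `p γ_i γ_j = S_ij + t τ_ij`, `p γ_i γ_k = t (a + t) u_k`, `p γ_j γ_k = t (b + t) u_k`
  -- and `p γ_k γ_l = O(t²)`; `D` then adjusts the diagonal exactly.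
  let γ : ℝ → Fin m → ℝ := fun t k =>
    if k = i then a + t else if k = j then b + t else u' k * t * ((a + t) * (b + t)) / s t
  let p : ℝ → ℝ := fun t => s t / ((a + t) * (b + t))
  let D : ℝ → Fin m → ℝ := fun t k => S k k + t * symMatrix τ k k - p t * γ t k ^ 2
  let M : ℝ → Matrix (Fin m) (Fin m) ℝ := fun t =>
    Matrix.diagonal (D t) + p t • Matrix.vecMulVec (γ t) (γ t)
  have hpos : ∀ᶠ t : ℝ in 𝓝[>] 0, 0 < t := self_mem_nhdsWithin
  have hne : ∀ c : ℝ, ∀ᶠ t : ℝ in 𝓝[>] 0, c + t ≠ 0 := by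
    intro c
    rcases lt_or_ge c 0 with hc | hc
    · have : ∀ᶠ t : ℝ in 𝓝[>] 0, t < -c :=
        nhdsWithin_le_nhds (eventually_lt_nhds (by linarith))
      filter_upwards [this] with t ht
      linarith
    · filter_upwards [hpos] with t ht
      linarith
  have hslim : Tendsto s (𝓝[>] 0) (𝓝 (S i j)) := by
    have : Continuous s := by fun_prop
    have h := (this.tendsto 0).mono_left (nhdsWithin_le_nhds (s := Set.Ioi 0))
    simpa [s] using h
  have hsne : ∀ᶠ t : ℝ in 𝓝[>] 0, s t ≠ 0 := hslim.eventually_ne hs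
  have hid : Tendsto (fun t : ℝ => t) (𝓝[>] 0) (𝓝 0) := nhdsWithin_le_nhds
  have hMsymm : ∀ t, (M t).IsSymm := by
    intro t
    refine (Matrix.isSymm_diagonal _).add ?_
    rw [Matrix.IsSymm, Matrix.transpose_smul, Matrix.transpose_vecMulVec]
  have hMne : ∀ t k l, k ≠ l → M t k l = p t * (γ t k * γ t l) := by
    intro t k l hkl
    simp [M, Matrix.diagonal_apply_ne _ hkl, Matrix.vecMulVec_apply]
  have hγi : ∀ t, γ t i = a + t := fun t => if_pos rfl
  have hγj : ∀ t, γ t j = b + t := fun t => by simp [γ, hij.symm]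
  have hγk : ∀ t k, k ≠ i → k ≠ j → γ t k = u' k * t * ((a + t) * (b + t)) / s t :=
    fun t k h h' => by simp [γ, h, h']
  let w : ℝ → SymIdx m → ℝ := fun t => t⁻¹ • (symCoords (M t) - symCoords S)
  have hentry_ik : ∀ k, k ≠ i → k ≠ j →
      Tendsto (fun t => t⁻¹ * (M t i k - S i k)) (𝓝[>] 0) (𝓝 (symMatrix τ i k)) := by
    intro k h h'
    have hlim : Tendsto (fun t => (a + t) * u' k) (𝓝[>] 0) (𝓝 ((a + 0) * u' k)) :=
      (hid.const_add a).mul_const _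
    rw [hui k h h']
    rw [add_zero] at hlim
    refine hlim.congr' ?_
    filter_upwards [hpos, hne a, hne b, hsne] with t ht ha hb hst
    rw [hMne t i k h.symm, h0 i k h.symm h h', hγi, hγk t k h h']
    simp only [p]
    field_simp
    ring
  have hentry_jk : ∀ k, k ≠ i → k ≠ j →
      Tendsto (fun t => t⁻¹ * (M t j k - S j k)) (𝓝[>] 0) (𝓝 (symMatrix τ j k)) := by
    intro k h h'
    have hlim : Tendsto (fun t => (b + t) * u' k) (𝓝[>] 0) (𝓝 ((b + 0) * u' k)) :=
      (hid.const_add b).mul_const _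
    rw [huj k h h']
    rw [add_zero] at hlim
    refine hlim.congr' ?_
    filter_upwards [hpos, hne a, hne b, hsne] with t ht ha hb hst
    rw [hMne t j k h'.symm, h0 j k h'.symm h h', hγj, hγk t k h h']
    simp only [p]
    field_simp
    ring
  have hentry_ij : Tendsto (fun t => t⁻¹ * (M t i j - S i j)) (𝓝[>] 0)
      (𝓝 (symMatrix τ i j)) := by
    refine tendsto_const_nhds.congr' ?_
    filter_upwards [hpos, hne a, hne b] with t ht ha hb
    rw [hMne t i j hij, hγi, hγj]
    simp only [p, s]
    field_simp
    ring
  have hentry_kl : ∀ k l, k ≠ i → k ≠ j → l ≠ i → l ≠ j → k ≠ l →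
      Tendsto (fun t => t⁻¹ * (M t k l - S k l)) (𝓝[>] 0) (𝓝 (symMatrix τ k l)) := by
    intro k l hk hk' hl hl' hkl
    have hlim : Tendsto (fun t => t * (u' k * u' l * ((a + t) * (b + t))) / s t) (𝓝[>] 0)
        (𝓝 (0 * (u' k * u' l * ((a + 0) * (b + 0))) / S i j)) :=
      (hid.mul (((hid.const_add a).mul (hid.const_add b)).const_mul _)).div hslim hs
    rw [h1 k l hk hk' hl hl' hkl]
    rw [zero_mul, zero_div] at hlim
    refine hlim.congr' ?_
    filter_upwards [hpos, hne a, hne b, hsne] with t ht ha hb hst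
    rw [hMne t k l hkl, h0 k l hkl hl hl', hγk t k hk hk', hγk t l hl hl']
    simp only [p]
    field_simp
    ring
  have hentry_kk : ∀ k,
      Tendsto (fun t => t⁻¹ * (M t k k - S k k)) (𝓝[>] 0) (𝓝 (symMatrix τ k k)) := by
    intro k
    refine tendsto_const_nhds.congr' ?_
    filter_upwards [hpos] with t ht
    have : M t k k = S k k + t * symMatrix τ k k := by
      simp only [M, Matrix.add_apply, Matrix.diagonal_apply_eq, D, Matrix.smul_apply,
        Matrix.vecMulVec_apply, smul_eq_mul]
      ring
    rw [this]
    field_simp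
    ring
  have hswap : ∀ k l, Tendsto (fun t => t⁻¹ * (M t k l - S k l)) (𝓝[>] 0)
      (𝓝 (symMatrix τ k l)) →
      Tendsto (fun t => t⁻¹ * (M t l k - S l k)) (𝓝[>] 0) (𝓝 (symMatrix τ l k)) := by
    intro k l h
    rw [(symMatrix_isSymm τ).apply k l]
    simpa only [(hMsymm _).apply k l, hS.apply k l] using h
  have hentry : ∀ k l,
      Tendsto (fun t => t⁻¹ * (M t k l - S k l)) (𝓝[>] 0) (𝓝 (symMatrix τ k l)) := by
    intro k l
    rcases eq_or_ne k l with rfl | hkl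
    · exact hentry_kk k
    by_cases hki : k = i
    · subst hki
      by_cases hlj : l = j
      · subst hlj; exact hentry_ij
      · exact hentry_ik l hkl.symm hlj
    by_cases hkj : k = j
    · subst hkj
      by_cases hli : l = i
      · subst hli; exact hswap _ _ hentry_ij
      · exact hentry_jk l hli hkl.symm
    by_cases hli : l = i
    · subst hli; exact hswap _ _ (hentry_ik k hki hkj)
    by_cases hlj : l = j
    · subst hlj; exact hswap _ _ (hentry_jk k hki hkj)
    exact hentry_kl k l hki hkj hli hlj hkl
  refine mem_algebraicTangentCone_of_tendsto (w := w) ?_ fun f hf => ?_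
  · rw [tendsto_pi_nhds]
    rintro ⟨⟨k, l⟩, hkl⟩
    have := hentry k l
    rw [symMatrix_apply, symIdx_of_le hkl] at this
    exact this
  · filter_upwards [hpos] with t ht
    have : t • w t + symCoords S = symCoords (M t) := by
      simp only [w]
      rw [smul_smul, mul_inv_cancel₀ ht.ne', one_smul, sub_add_cancel]
    rw [this]
    exact eval_symCoords_diagonal_add_smul_vecMulVec hf _ _ _

theorem mem_algebraicTangentCone_iff (hS : S.IsSymm) (hij : i ≠ j)
    (hs : S i j ≠ 0) (h0 : ∀ a b, a ≠ b → b ≠ i → b ≠ j → S a b = 0) :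
    τ ∈ algebraicTangentCone (symCoords '' factorModel m 1) (symCoords S) ↔
      (∀ k l, k ≠ i → k ≠ j → l ≠ i → l ≠ j → k ≠ l → symMatrix τ k l = 0) ∧
      ∀ k l, k ≠ i → k ≠ j → l ≠ i → l ≠ j →
        symMatrix τ i k * symMatrix τ j l = symMatrix τ i l * symMatrix τ j k :=
  ⟨fun h => ⟨fun _ _ hki hkj hli hlj hkl =>
      apply_eq_zero_of_mem_algebraicTangentCone hS hij hs h0 h hki hkj hli hlj hkl,
    fun _ _ hki hkj hli hlj =>
      minor_eq_zero_of_mem_algebraicTangentCone hS hij h0 h hki hkj hli hlj⟩,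
  fun h => mem_algebraicTangentCone_of_minors hS hij hs h0 h.1 h.2⟩

end FactorAnalysisConeConverse

/-! ### Simultaneous diagonalization by congruence. -/

section SimultaneousDiagonalization

variable {ι : Type*} [Fintype ι] [DecidableEq ι]

/-- A positive definite and a symmetric matrix are simultaneously diagonalized by a congruence. -/
theorem Matrix.PosDef.exists_congr_one_diagonal {S X : Matrix ι ι ℝ} (hS : S.PosDef)
    (hX : X.IsSymm) : ∃ (B C : Matrix ι ι ℝ) (lam : ι → ℝ),
      C * B = 1 ∧ B * Bᵀ = S ∧ B * Matrix.diagonal lam * Bᵀ = X := by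
  -- With `S = yᵀ y` and a spectral decomposition `y⁻ᵀ X y⁻¹ = U Λ Uᵀ`, the congruence is `B = yᵀ
  -- U`.
  obtain ⟨y, hy, hyS⟩ := CStarAlgebra.isStrictlyPositive_iff_eq_star_mul_self.mp
    hS.isStrictlyPositive
  rw [Matrix.star_eq_conjTranspose, Matrix.conjTranspose_eq_transpose_of_trivial] at hyS
  have hdet : IsUnit y.det := (Matrix.isUnit_iff_isUnit_det y).mp hy
  have hN : (y⁻¹ᵀ * X * y⁻¹).IsHermitian := by
    rw [Matrix.IsHermitian, Matrix.conjTranspose_eq_transpose_of_trivial, Matrix.transpose_mul,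
      Matrix.transpose_mul, hX.eq, Matrix.transpose_transpose, Matrix.mul_assoc]
  set U : Matrix ι ι ℝ := (hN.eigenvectorUnitary : Matrix ι ι ℝ) with hU
  have hUU : U * Uᵀ = 1 := by
    have := Matrix.mem_unitaryGroup_iff.mp hN.eigenvectorUnitary.2
    rwa [Matrix.star_eq_conjTranspose, Matrix.conjTranspose_eq_transpose_of_trivial] at this
  have hsp : y⁻¹ᵀ * X * y⁻¹ = U * Matrix.diagonal hN.eigenvalues * Uᵀ := by
    have := hN.spectral_theorem
    rw [Unitary.conjStarAlgAut_apply, Matrix.star_eq_conjTranspose,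
      Matrix.conjTranspose_eq_transpose_of_trivial] at this
    exact this
  have h1 : y⁻¹ * y = 1 := Matrix.nonsing_inv_mul y hdet
  have h2 : y * y⁻¹ = 1 := Matrix.mul_nonsing_inv y hdet
  have h2' : yᵀ * y⁻¹ᵀ = 1 := by rw [← Matrix.transpose_mul, h1, Matrix.transpose_one]
  have h1' : y⁻¹ᵀ * yᵀ = 1 := by rw [← Matrix.transpose_mul, h2, Matrix.transpose_one]
  have hUU' : Uᵀ * U = 1 := mul_eq_one_comm.mp hUU
  refine ⟨yᵀ * U, Uᵀ * y⁻¹ᵀ, hN.eigenvalues, ?_, ?_, ?_⟩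
  · rw [Matrix.mul_assoc, ← Matrix.mul_assoc y⁻¹ᵀ, h1', Matrix.one_mul, hUU']
  · rw [Matrix.transpose_mul, Matrix.transpose_transpose, Matrix.mul_assoc, ← Matrix.mul_assoc U,
      hUU, Matrix.one_mul, hyS]
  · calc yᵀ * U * Matrix.diagonal hN.eigenvalues * (yᵀ * U)ᵀ
        = yᵀ * (U * Matrix.diagonal hN.eigenvalues * Uᵀ) * y := by
          rw [Matrix.transpose_mul, Matrix.transpose_transpose]; simp only [Matrix.mul_assoc]
      _ = (yᵀ * y⁻¹ᵀ) * X * (y⁻¹ * y) := by rw [← hsp]; simp only [Matrix.mul_assoc]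
      _ = X := by rw [h1, h2', Matrix.one_mul, Matrix.mul_one]

end SimultaneousDiagonalization

/-! ### Gaussian moments and whitening. -/

section GaussianMoments

theorem integral_sq_gaussianReal : ∫ x : ℝ, x ^ 2 ∂(gaussianReal 0 1) = 1 := by
  have h := variance_fun_id_gaussianReal (μ := 0) (v := 1)
  rw [variance_of_integral_eq_zero (by fun_prop) (by simp)] at h
  simpa using h

/-- The moment is read off as the fourth derivative at `0` of the moment generating function `exp
(t² / 2)`. -/
theorem integral_pow_four_gaussianReal : ∫ x : ℝ, x ^ 4 ∂(gaussianReal 0 1) = 3 := by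
  have h := iteratedDeriv_mgf_zero (X := id) (μ := gaussianReal 0 1)
    (by rw [integrableExpSet_id_gaussianReal]; simp) 4
  have hm : mgf id (gaussianReal 0 1) = fun t => Real.exp (t ^ 2 / 2) := by
    rw [mgf_id_gaussianReal]; simp
  have he : ∀ t : ℝ, HasDerivAt (fun t : ℝ => Real.exp (t ^ 2 / 2)) (Real.exp (t ^ 2 / 2) * t) t := by
    intro t
    have h1 : HasDerivAt (fun t : ℝ => t ^ 2 / 2) t t := by
      refine (((hasDerivAt_id' t).fun_pow 2).div_const 2).congr_deriv ?_
      simp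
    exact h1.exp
  have d1 : deriv (fun t : ℝ => Real.exp (t ^ 2 / 2)) = fun t => Real.exp (t ^ 2 / 2) * t :=
    funext fun t => (he t).deriv
  have d2 : deriv (fun t : ℝ => Real.exp (t ^ 2 / 2) * t)
      = fun t => Real.exp (t ^ 2 / 2) * (t ^ 2 + 1) := by
    funext t
    exact ((he t).fun_mul (hasDerivAt_id' t)).deriv.trans (by ring)
  have d3 : deriv (fun t : ℝ => Real.exp (t ^ 2 / 2) * (t ^ 2 + 1))
      = fun t => Real.exp (t ^ 2 / 2) * (t ^ 3 + 3 * t) := by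
    funext t
    exact ((he t).fun_mul (((hasDerivAt_id' t).fun_pow 2).add_const 1)).deriv.trans
      (by push_cast; ring)
  have d4 : deriv (fun t : ℝ => Real.exp (t ^ 2 / 2) * (t ^ 3 + 3 * t))
      = fun t => Real.exp (t ^ 2 / 2) * (t ^ 4 + 6 * t ^ 2 + 3) := by
    funext t
    exact ((he t).fun_mul (((hasDerivAt_id' t).fun_pow 3).fun_add
      ((hasDerivAt_id' t).const_mul 3))).deriv.trans (by push_cast; ring)
  rw [hm, iteratedDeriv_succ, iteratedDeriv_succ, iteratedDeriv_succ, iteratedDeriv_one,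
    d1, d2, d3, d4] at h
  simpa using h.symm

theorem integrable_sq_gaussianReal : Integrable (fun x : ℝ => x ^ 2) (gaussianReal 0 1) :=
  (memLp_id_gaussianReal' (μ := 0) (v := 1) 2 (by norm_num)).integrable_sq

theorem integrable_pow_four_gaussianReal :
    Integrable (fun x : ℝ => x ^ 4) (gaussianReal 0 1) := by
  have h := (memLp_id_gaussianReal' (μ := 0) (v := 1) 4 (by norm_num)).integrable_norm_pow
    (p := 4) (by norm_num)
  refine h.congr (ae_of_all _ fun x => ?_)
  simp only [id_eq, Real.norm_eq_abs]
  exact Even.pow_abs (by decide) x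

theorem memLp_const_mul_sq_sub_one_gaussianReal (c : ℝ) :
    MemLp (fun x : ℝ => c * (x ^ 2 - 1)) 2 (gaussianReal 0 1) := by
  refine MemLp.const_mul (MemLp.sub ?_ (memLp_const 1)) c
  rw [memLp_two_iff_integrable_sq (by fun_prop)]
  simpa only [← pow_mul] using integrable_pow_four_gaussianReal

theorem integral_const_mul_sq_sub_one_gaussianReal (c : ℝ) :
    ∫ x : ℝ, c * (x ^ 2 - 1) ∂(gaussianReal 0 1) = 0 := by
  rw [integral_const_mul, integral_sub, integral_sq_gaussianReal]
  · simp
  · exact integrable_sq_gaussianReal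
  · exact integrable_const _

theorem variance_const_mul_sq_sub_one_gaussianReal (c : ℝ) :
    Var[fun x : ℝ => c * (x ^ 2 - 1); gaussianReal 0 1] = 2 * c ^ 2 := by
  rw [variance_of_integral_eq_zero (by fun_prop) (integral_const_mul_sq_sub_one_gaussianReal c)]
  have h2 := integrable_sq_gaussianReal
  have h4 := integrable_pow_four_gaussianReal
  have : ∀ x : ℝ, (c * (x ^ 2 - 1)) ^ 2 = c ^ 2 * (x ^ 4 - 2 * x ^ 2 + 1) := fun x => by ring
  simp_rw [this]
  rw [integral_const_mul, integral_add (show Integrable (fun x : ℝ => x ^ 4 - 2 * x ^ 2) _ from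
      h4.sub (h2.const_mul 2)) (integrable_const _),
    integral_sub h4 (h2.const_mul 2), integral_const_mul, integral_sq_gaussianReal,
    integral_pow_four_gaussianReal]
  simp
  ring

variable {ι κ : Type*} [Fintype ι] [Fintype κ]

theorem memLp_sum_mul_sq_sub_one_pi_gaussianReal (c : ι → ℝ) :
    MemLp (fun y : ι → ℝ => ∑ i, c i * (y i ^ 2 - 1)) 2
      (Measure.pi fun _ => gaussianReal 0 1) := by
  refine memLp_finsetSum _ fun i _ => ?_
  exact (memLp_const_mul_sq_sub_one_gaussianReal (c i)).comp_measurePreserving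
    (measurePreserving_eval (fun _ : ι => gaussianReal 0 1) i)

/-- The summands are independent and centered, so the second moment is the sum of the variances, and
`y²` has variance `3 - 1 = 2`. -/
theorem integral_sum_mul_sq_sub_one_sq_pi_gaussianReal (c : ι → ℝ) :
    ∫ y : ι → ℝ, (∑ i, c i * (y i ^ 2 - 1)) ^ 2 ∂(Measure.pi fun _ => gaussianReal 0 1)
      = 2 * ∑ i, c i ^ 2 := by
  have h0 : ∫ y : ι → ℝ, (∑ i, c i * (y i ^ 2 - 1)) ∂(Measure.pi fun _ => gaussianReal 0 1)
      = 0 := by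
    rw [integral_finsetSum]
    · refine Finset.sum_eq_zero fun i _ => ?_
      rw [integral_comp_eval (μ := fun _ : ι => gaussianReal 0 1)
        (f := fun x : ℝ => c i * (x ^ 2 - 1)) (by fun_prop)]
      exact integral_const_mul_sq_sub_one_gaussianReal (c i)
    · intro i _
      exact ((memLp_const_mul_sq_sub_one_gaussianReal (c i)).comp_measurePreserving
        (measurePreserving_eval (fun _ : ι => gaussianReal 0 1) i)).integrable (by norm_num)
  rw [← variance_of_integral_eq_zero
    (memLp_sum_mul_sq_sub_one_pi_gaussianReal c).aestronglyMeasurable.aemeasurable h0]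
  have := variance_sum_pi (μ := fun _ : ι => gaussianReal 0 1)
    (X := fun i x => c i * (x ^ 2 - 1)) (fun i => memLp_const_mul_sq_sub_one_gaussianReal (c i))
  rw [Finset.mul_sum, ← Finset.sum_congr rfl
    (fun i _ => variance_const_mul_sq_sub_one_gaussianReal (c i)), ← this]
  congr 1
  ext y
  simp

variable [DecidableEq ι] [DecidableEq κ]

/-- Whitening: if `C S Cᵗ = 1` then `C x` is standard normal for `x ∼ N(0, S)`. -/
theorem map_mulVec_multivariateGaussian {S : Matrix ι ι ℝ} (hS : S.PosSemidef)
    {C : Matrix κ ι ℝ} (hC : C * S * Cᵀ = 1) :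
    (multivariateGaussian 0 S).map (fun x => C *ᵥ x.ofLp)
      = Measure.pi fun _ => gaussianReal 0 1 := by
  have h1 : (multivariateGaussian 0 S).map (fun x => WithLp.toLp 2 (C *ᵥ x.ofLp))
      = stdGaussian (EuclideanSpace ℝ κ) := by
    apply Measure.ext_of_charFun
    ext t
    have h2 : charFun ((multivariateGaussian 0 S).map (fun x => WithLp.toLp 2 (C *ᵥ x.ofLp))) t
        = charFun (multivariateGaussian 0 S) (WithLp.toLp 2 (Cᵀ *ᵥ t.ofLp)) := by
      rw [charFun_apply, charFun_apply, integral_map (by fun_prop) (by fun_prop)]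
      congr 1
      ext x
      congr 3
      rw [EuclideanSpace.inner_eq_star_dotProduct, EuclideanSpace.inner_eq_star_dotProduct]
      simp only [star_trivial]
      rw [Matrix.mulVec_transpose, Matrix.dotProduct_mulVec]
    rw [h2, charFun_multivariateGaussian hS, charFun_stdGaussian]
    have h3 : (Cᵀ *ᵥ t.ofLp) ⬝ᵥ S *ᵥ (Cᵀ *ᵥ t.ofLp) = ‖t‖ ^ 2 := by
      rw [Matrix.mulVec_mulVec, Matrix.mulVec_transpose, ← Matrix.dotProduct_mulVec,
        Matrix.mulVec_mulVec, ← Matrix.mul_assoc, hC, Matrix.one_mulVec,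
        EuclideanSpace.real_norm_sq_eq]
      simp [dotProduct, sq]
    rw [h3]
    simp [neg_div]
  have h4 : (fun x : EuclideanSpace ℝ ι => C *ᵥ x.ofLp)
      = WithLp.ofLp ∘ (fun x : EuclideanSpace ℝ ι => WithLp.toLp 2 (C *ᵥ x.ofLp)) := rfl
  rw [h4, ← Measure.map_map (by fun_prop) (by fun_prop), h1, ← map_pi_eq_stdGaussian,
    Measure.map_map (by fun_prop) (by fun_prop)]
  exact Measure.map_id

end GaussianMoments

/-! ### The score and the Fisher information of the centered normal model. -/

section Fisher

variable {m : ℕ}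

theorem symMatrix_add (θ η : SymIdx m → ℝ) : symMatrix (θ + η) = symMatrix θ + symMatrix η := rfl

theorem symMatrix_smul (c : ℝ) (θ : SymIdx m → ℝ) : symMatrix (c • θ) = c • symMatrix θ := rfl

theorem symMatrix_eq_sum (v : SymIdx m → ℝ) :
    symMatrix v = ∑ a, v a • symMatrix (Pi.single a (1 : ℝ)) := by
  ext i j
  simp only [Matrix.sum_apply, Matrix.smul_apply, symMatrix_apply, smul_eq_mul]
  rw [Finset.sum_eq_single (symIdx i j)]
  · simp
  · intro b _ hb
    simp [hb.symm]
  · simp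

variable {ι : Type*} [Fintype ι] [DecidableEq ι]

/-- The derivative of the log-density of `N(0, S)` in the direction of a symmetric matrix, as a
function of the direction. -/
noncomputable def scoreForm (S : Matrix ι ι ℝ) (x : ι → ℝ) : Matrix ι ι ℝ →ₗ[ℝ] ℝ where
  toFun X := (x ⬝ᵥ (S⁻¹ * X * S⁻¹) *ᵥ x - (S⁻¹ * X).trace) / 2
  map_add' X Y := by
    simp only [Matrix.mul_add, Matrix.add_mul, Matrix.add_mulVec, dotProduct_add,
      Matrix.trace_add]
    ring
  map_smul' c X := by
    simp only [Matrix.mul_smul, Matrix.smul_mul, Matrix.smul_mulVec, dotProduct_smul,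
      Matrix.trace_smul, smul_eq_mul, RingHom.id_apply]
    ring

section Congruence

variable {S X B C : Matrix ι ι ℝ} {lam : ι → ℝ}

theorem inv_eq_transpose_mul_of_congr (hCB : C * B = 1) (hS : B * Bᵀ = S) : S⁻¹ = Cᵀ * C := by
  apply Matrix.inv_eq_left_inv
  have hBC : B * C = 1 := mul_eq_one_comm.mp hCB
  rw [← hS, Matrix.mul_assoc, ← Matrix.mul_assoc C, hCB, Matrix.one_mul, ← Matrix.transpose_mul,
    hBC, Matrix.transpose_one]

theorem dotProduct_congr_diagonal_mulVec (C : Matrix ι ι ℝ) (d : ι → ℝ) (x : ι → ℝ) :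
    x ⬝ᵥ (Cᵀ * Matrix.diagonal d * C) *ᵥ x = ∑ k, d k * (C *ᵥ x) k ^ 2 := by
  rw [Matrix.mul_assoc, ← Matrix.mulVec_mulVec, Matrix.dotProduct_mulVec, Matrix.vecMul_transpose,
    ← Matrix.mulVec_mulVec]
  simp only [dotProduct, Matrix.mulVec_diagonal]
  exact Finset.sum_congr rfl fun k _ => by ring

theorem inv_mul_of_congr (hCB : C * B = 1) (hS : B * Bᵀ = S)
    (hX : B * Matrix.diagonal lam * Bᵀ = X) : S⁻¹ * X = Cᵀ * Matrix.diagonal lam * Bᵀ := by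
  rw [inv_eq_transpose_mul_of_congr hCB hS, ← hX]
  calc Cᵀ * C * (B * Matrix.diagonal lam * Bᵀ)
      = Cᵀ * (C * B) * Matrix.diagonal lam * Bᵀ := by simp only [Matrix.mul_assoc]
    _ = _ := by rw [hCB, Matrix.mul_one]

/-- After diagonalizing `S` and `X` together, the score becomes a weighted sum of `y_k² - 1` in `y =
C x`, which is standard normal under `N(0, S)`; its moments are then those of the previous part. -/
theorem scoreForm_eq_of_congr (hCB : C * B = 1) (hS : B * Bᵀ = S)
    (hX : B * Matrix.diagonal lam * Bᵀ = X) (x : ι → ℝ) :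
    scoreForm S x X = ∑ k, lam k / 2 * ((C *ᵥ x) k ^ 2 - 1) := by
  have h3 : Bᵀ * Cᵀ = 1 := by rw [← Matrix.transpose_mul, hCB, Matrix.transpose_one]
  have h1 : S⁻¹ * X * S⁻¹ = Cᵀ * Matrix.diagonal lam * C := by
    rw [inv_mul_of_congr hCB hS hX, inv_eq_transpose_mul_of_congr hCB hS, Matrix.mul_assoc,
      ← Matrix.mul_assoc Bᵀ, h3, Matrix.one_mul]
  have h2 : (S⁻¹ * X).trace = ∑ k, lam k := by
    rw [inv_mul_of_congr hCB hS hX, Matrix.mul_assoc, Matrix.trace_mul_comm, Matrix.mul_assoc, h3,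
      Matrix.mul_one, Matrix.trace_diagonal]
  simp only [scoreForm, LinearMap.coe_mk, AddHom.coe_mk]
  rw [h1, h2, dotProduct_congr_diagonal_mulVec, ← Finset.sum_sub_distrib, Finset.sum_div]
  exact Finset.sum_congr rfl fun k _ => by ring

theorem trace_inv_mul_sq_of_congr (hCB : C * B = 1) (hS : B * Bᵀ = S)
    (hX : B * Matrix.diagonal lam * Bᵀ = X) :
    (S⁻¹ * X * (S⁻¹ * X)).trace = ∑ k, lam k ^ 2 := by
  have h3 : Bᵀ * Cᵀ = 1 := by rw [← Matrix.transpose_mul, hCB, Matrix.transpose_one]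
  rw [inv_mul_of_congr hCB hS hX]
  have : Cᵀ * Matrix.diagonal lam * Bᵀ * (Cᵀ * Matrix.diagonal lam * Bᵀ)
      = Cᵀ * (Matrix.diagonal lam * (Bᵀ * Cᵀ) * Matrix.diagonal lam * Bᵀ) := by
    simp only [Matrix.mul_assoc]
  rw [this, h3, Matrix.trace_mul_comm, Matrix.mul_assoc, h3, Matrix.mul_one, Matrix.mul_one,
    Matrix.diagonal_mul_diagonal, Matrix.trace_diagonal]
  exact Finset.sum_congr rfl fun k _ => by ring

end Congruence

theorem memLp_scoreForm {S X : Matrix ι ι ℝ} (hS : S.PosDef) (hX : X.IsSymm) :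
    MemLp (fun x : EuclideanSpace ℝ ι => scoreForm S x.ofLp X) 2 (multivariateGaussian 0 S) := by
  obtain ⟨B, C, lam, hCB, hBS, hBX⟩ := hS.exists_congr_one_diagonal hX
  have hC : C * S * Cᵀ = 1 := by
    rw [← hBS, ← Matrix.mul_assoc, hCB, Matrix.one_mul, ← Matrix.transpose_mul, hCB,
      Matrix.transpose_one]
  have hmp : MeasurePreserving (fun x : EuclideanSpace ℝ ι => C *ᵥ x.ofLp)
      (multivariateGaussian 0 S) (Measure.pi fun _ => gaussianReal 0 1) :=
    ⟨by fun_prop, map_mulVec_multivariateGaussian hS.posSemidef hC⟩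
  simp only [scoreForm_eq_of_congr hCB hBS hBX]
  exact (memLp_sum_mul_sq_sub_one_pi_gaussianReal fun k => lam k / 2).comp_measurePreserving hmp

theorem integral_scoreForm_sq {S X : Matrix ι ι ℝ} (hS : S.PosDef) (hX : X.IsSymm) :
    ∫ x : EuclideanSpace ℝ ι, scoreForm S x.ofLp X ^ 2 ∂(multivariateGaussian 0 S)
      = (S⁻¹ * X * (S⁻¹ * X)).trace / 2 := by
  obtain ⟨B, C, lam, hCB, hBS, hBX⟩ := hS.exists_congr_one_diagonal hX
  have hC : C * S * Cᵀ = 1 := by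
    rw [← hBS, ← Matrix.mul_assoc, hCB, Matrix.one_mul, ← Matrix.transpose_mul, hCB,
      Matrix.transpose_one]
  simp only [scoreForm_eq_of_congr hCB hBS hBX]
  rw [trace_inv_mul_sq_of_congr hCB hBS hBX]
  have h := integral_sum_mul_sq_sub_one_sq_pi_gaussianReal fun k => lam k / 2
  rw [← map_mulVec_multivariateGaussian hS.posSemidef hC, integral_map (by fun_prop)] at h
  · rw [h, Finset.mul_sum, Finset.sum_div]
    exact Finset.sum_congr rfl fun k _ => by ring
  · rw [map_mulVec_multivariateGaussian hS.posSemidef hC]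
    exact ((memLp_sum_mul_sq_sub_one_pi_gaussianReal fun k => lam k / 2).integrable_sq).1

/-- Along the line, `S + t X = B diag(1 + t λ) Bᵀ`, so determinant and inverse are explicit in the
scalars `1 + t λ_k`, and no matrix calculus is needed. -/
theorem hasDerivAt_log_normalDensity {S X : Matrix (Fin m) (Fin m) ℝ} (hS : S.PosDef)
    (hX : X.IsSymm) (x : Fin m → ℝ) :
    HasDerivAt (fun t : ℝ => Real.log (normalDensity (S + t • X) x)) (scoreForm S x X) 0 := by
  obtain ⟨B, C, lam, hCB, hBS, hBX⟩ := hS.exists_congr_one_diagonal hX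
  rw [scoreForm_eq_of_congr hCB hBS hBX]
  have hBC : B * C = 1 := mul_eq_one_comm.mp hCB
  have hsum : ∀ t : ℝ, S + t • X = B * Matrix.diagonal (fun k => 1 + t * lam k) * Bᵀ := by
    intro t
    have : (Matrix.diagonal fun k => 1 + t * lam k) = 1 + t • Matrix.diagonal lam := by
      rw [← Matrix.diagonal_one, ← Matrix.diagonal_smul, Matrix.diagonal_add]
      rfl
    rw [this, Matrix.mul_add, Matrix.add_mul, Matrix.mul_one, hBS, Matrix.mul_smul,
      Matrix.smul_mul, hBX]
  have hpos : ∀ᶠ t : ℝ in 𝓝 0, ∀ k, 0 < 1 + t * lam k := by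
    rw [eventually_all]
    intro k
    have : Continuous fun t : ℝ => 1 + t * lam k := by fun_prop
    exact this.continuousAt.eventually_const_lt (by simp)
  have hB0 : B.det ≠ 0 := by
    intro h
    have := congrArg Matrix.det hCB
    rw [Matrix.det_mul, h] at this
    simp at this
  have hc : (2 * Real.pi) ^ m * B.det ^ 2 ≠ 0 :=
    mul_ne_zero (pow_ne_zero _ (by positivity)) (pow_ne_zero _ hB0)
  have hformula : ∀ᶠ t : ℝ in 𝓝 0, Real.log (normalDensity (S + t • X) x) =
      -(Real.log ((2 * Real.pi) ^ m * B.det ^ 2) + ∑ k, Real.log (1 + t * lam k)) / 2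
        - (∑ k, (1 + t * lam k)⁻¹ * (C *ᵥ x) k ^ 2) / 2 := by
    filter_upwards [hpos] with t ht
    have hdet : (S + t • X).det = B.det ^ 2 * ∏ k, (1 + t * lam k) := by
      rw [hsum, Matrix.det_mul, Matrix.det_mul, Matrix.det_diagonal, Matrix.det_transpose]
      ring
    have hinv : (S + t • X)⁻¹ = Cᵀ * Matrix.diagonal (fun k => (1 + t * lam k)⁻¹) * C := by
      apply Matrix.inv_eq_left_inv
      rw [hsum]
      calc Cᵀ * Matrix.diagonal (fun k => (1 + t * lam k)⁻¹) * C *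
            (B * Matrix.diagonal (fun k => 1 + t * lam k) * Bᵀ)
          = Cᵀ * (Matrix.diagonal (fun k => (1 + t * lam k)⁻¹) * (C * B) *
            Matrix.diagonal (fun k => 1 + t * lam k)) * Bᵀ := by simp only [Matrix.mul_assoc]
        _ = Cᵀ * 1 * Bᵀ := by
            rw [hCB, Matrix.mul_one, Matrix.diagonal_mul_diagonal]
            congr 2
            rw [← Matrix.diagonal_one]
            congr 1
            funext k
            exact inv_mul_cancel₀ (ht k).ne'
        _ = 1 := by
            rw [Matrix.mul_one, ← Matrix.transpose_mul, hBC, Matrix.transpose_one]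
    have hP : 0 < ∏ k, (1 + t * lam k) := Finset.prod_pos fun k _ => ht k
    have hpi : 0 < (2 * Real.pi) ^ m * B.det ^ 2 := by positivity
    rw [normalDensity, hdet, hinv, dotProduct_congr_diagonal_mulVec, ← mul_assoc,
      Real.log_mul (by positivity) (by positivity), Real.log_exp, Real.log_inv,
      Real.log_sqrt (by positivity), Real.log_mul hc hP.ne',
      Real.log_prod (fun k _ => (ht k).ne')]
    ring
  refine HasDerivAt.congr_of_eventuallyEq ?_ hformula
  have hlin : ∀ k, HasDerivAt (fun t : ℝ => 1 + t * lam k) (lam k) 0 := fun k => by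
    simpa using ((hasDerivAt_id' (0 : ℝ)).mul_const (lam k)).const_add 1
  have h1 : HasDerivAt (fun t : ℝ => ∑ k, Real.log (1 + t * lam k)) (∑ k, lam k) 0 := by
    refine (HasDerivAt.fun_sum fun k _ => (hlin k).log (by simp)).congr_deriv ?_
    simp
  have h2 : HasDerivAt (fun t : ℝ => ∑ k, (1 + t * lam k)⁻¹ * (C *ᵥ x) k ^ 2)
      (∑ k, -lam k * (C *ᵥ x) k ^ 2) 0 := by
    refine (HasDerivAt.fun_sum fun k _ =>
      ((hlin k).fun_inv (by simp)).mul_const ((C *ᵥ x) k ^ 2)).congr_deriv ?_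
    simp
  refine (((h1.const_add _).fun_neg.div_const 2).fun_sub (h2.div_const 2)).congr_deriv ?_
  rw [← Finset.sum_neg_distrib, Finset.sum_div, Finset.sum_div, ← Finset.sum_sub_distrib]
  exact Finset.sum_congr rfl fun k _ => by ring

theorem normalScore_eq_scoreForm {S : Matrix (Fin m) (Fin m) ℝ} (hS : S.PosDef) (a : SymIdx m)
    (x : Fin m → ℝ) : normalScore S a x = scoreForm S x (symMatrix (Pi.single a (1 : ℝ))) := by
  have hsymm : S.IsSymm := hS.isHermitian
  unfold normalScore
  simp only [symMatrix_add, symMatrix_smul, symMatrix_symCoords hsymm]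
  exact (hasDerivAt_log_normalDensity hS (symMatrix_isSymm _) x).deriv

theorem fisherInformation_isSymm (S : Matrix (Fin m) (Fin m) ℝ) : (fisherInformation S).IsSymm := by
  ext a b
  simp only [fisherInformation, Matrix.transpose_apply, Matrix.of_apply, mul_comm]

/-- The quadratic form of the Fisher information of the centered normal model. -/
theorem dotProduct_fisherInformation_mulVec {S : Matrix (Fin m) (Fin m) ℝ} (hS : S.PosDef)
    (v : SymIdx m → ℝ) :
    v ⬝ᵥ fisherInformation S *ᵥ v = (S⁻¹ * symMatrix v * (S⁻¹ * symMatrix v)).trace / 2 := by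
  rw [← integral_scoreForm_sq hS (symMatrix_isSymm v)]
  have hmem := fun a : SymIdx m => memLp_scoreForm hS (symMatrix_isSymm (Pi.single a (1 : ℝ)))
  have hint : ∀ a b : SymIdx m, Integrable (fun x : EuclideanSpace ℝ (Fin m) =>
      (v a * v b) * (scoreForm S x.ofLp (symMatrix (Pi.single a (1 : ℝ))) *
        scoreForm S x.ofLp (symMatrix (Pi.single b (1 : ℝ))))) (multivariateGaussian 0 S) :=
    fun a b => ((hmem a).integrable_mul (hmem b)).const_mul _
  -- The score is linear in the direction, so the Fisher quadratic form at `v` is the second moment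
  -- of the score in direction `v`.
  have hexp : ∀ x : EuclideanSpace ℝ (Fin m), scoreForm S x.ofLp (symMatrix v) ^ 2 =
      ∑ a, ∑ b, (v a * v b) * (scoreForm S x.ofLp (symMatrix (Pi.single a (1 : ℝ))) *
        scoreForm S x.ofLp (symMatrix (Pi.single b (1 : ℝ)))) := by
    intro x
    rw [symMatrix_eq_sum v, map_sum, sq, Finset.sum_mul_sum]
    refine Finset.sum_congr rfl fun a _ => Finset.sum_congr rfl fun b _ => ?_
    simp only [map_smul, smul_eq_mul]
    ring
  simp_rw [hexp]
  rw [integral_finsetSum _ fun a _ => integrable_finsetSum _ fun b _ => hint a b]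
  simp only [dotProduct, Matrix.mulVec, Finset.mul_sum]
  refine Finset.sum_congr rfl fun a _ => ?_
  rw [integral_finsetSum _ fun b _ => hint a b]
  refine Finset.sum_congr rfl fun b _ => ?_
  rw [integral_const_mul]
  simp only [fisherInformation, Matrix.of_apply, normalScore_eq_scoreForm hS]
  ring

end Fisher

/-! ### The smallest eigenvalue as a minimal Rayleigh quotient. -/

section SmallestEigenvalue

variable {p : ℕ}

/-- The smallest eigenvalue of a symmetric matrix is the minimum of its Rayleigh quotient. -/
theorem smallestEigenvalue_isLeast_rayleigh {M : Matrix (Fin p) (Fin p) ℝ} [NeZero p]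
    (hM : M.IsSymm) :
    (∀ w : Fin p → ℝ, smallestEigenvalue M * (w ⬝ᵥ w) ≤ w ⬝ᵥ M *ᵥ w) ∧
      ∃ w : Fin p → ℝ, w ⬝ᵥ w = 1 ∧ w ⬝ᵥ M *ᵥ w = smallestEigenvalue M := by
  -- Taking the identity as the positive definite matrix makes `B` orthogonal, so this is the
  -- spectral theorem.
  obtain ⟨B, C, lam, hCB, hBS, hBX⟩ := Matrix.PosDef.one.exists_congr_one_diagonal hM
  have hC : C = Bᵀ := by
    have := congrArg (C * ·) hBS
    simp only [← Matrix.mul_assoc, hCB, Matrix.one_mul, Matrix.mul_one] at this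
    exact this.symm
  subst hC
  obtain ⟨k₀, hk₀⟩ := Finite.exists_min lam
  have hquad : ∀ w, w ⬝ᵥ M *ᵥ w = ∑ k, lam k * (Bᵀ *ᵥ w) k ^ 2 := by
    intro w
    rw [← dotProduct_congr_diagonal_mulVec, Matrix.transpose_transpose, hBX]
  have hnorm : ∀ w, w ⬝ᵥ w = ∑ k, (Bᵀ *ᵥ w) k ^ 2 := by
    intro w
    have := dotProduct_congr_diagonal_mulVec Bᵀ 1 w
    rw [Matrix.transpose_transpose] at this
    simp only [Pi.one_apply, one_mul] at this
    rw [← this]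
    have h1 : (Matrix.diagonal (1 : Fin p → ℝ)) = 1 := Matrix.diagonal_one
    rw [h1, Matrix.mul_one, hBS, Matrix.one_mulVec]
  have hlow : ∀ w, lam k₀ * (w ⬝ᵥ w) ≤ w ⬝ᵥ M *ᵥ w := by
    intro w
    rw [hquad, hnorm, Finset.mul_sum]
    exact Finset.sum_le_sum fun k _ => mul_le_mul_of_nonneg_right (hk₀ k) (sq_nonneg _)
  have hvec : Bᵀ *ᵥ (B *ᵥ Pi.single k₀ 1) = Pi.single k₀ 1 := by
    rw [Matrix.mulVec_mulVec, hCB, Matrix.one_mulVec]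
  have hunit : (B *ᵥ Pi.single k₀ 1) ⬝ᵥ (B *ᵥ Pi.single k₀ 1) = 1 := by
    rw [hnorm, hvec]
    simp [Pi.single_apply]
  have hval : (B *ᵥ Pi.single k₀ 1) ⬝ᵥ M *ᵥ (B *ᵥ Pi.single k₀ 1) = lam k₀ := by
    rw [hquad, hvec]
    simp [Pi.single_apply]
  have hleast : IsLeast {c : ℝ | Module.End.HasEigenvalue (Matrix.toLin' M) c} (lam k₀) := by
    constructor
    · refine Module.End.hasEigenvalue_of_hasEigenvector (x := B *ᵥ Pi.single k₀ 1) ⟨?_, ?_⟩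
      · rw [Module.End.mem_eigenspace_iff, Matrix.toLin'_apply]
        conv_lhs => rw [← hBX]
        rw [← Matrix.mulVec_mulVec, hvec, ← Matrix.mulVec_mulVec, Matrix.mulVec_single_one,
          ← Matrix.mulVec_smul]
        congr 1
        ext k
        by_cases h : k = k₀ <;> simp [h]
      · intro h
        rw [h] at hunit
        simp at hunit
    · intro c hc
      obtain ⟨w, hw⟩ := hc.exists_hasEigenvector
      have h1 : M *ᵥ w = c • w := by
        rw [← Matrix.toLin'_apply]
        exact Module.End.mem_eigenspace_iff.mp hw.1
      have h2 := hlow w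
      rw [h1, dotProduct_smul, smul_eq_mul] at h2
      have h3 : 0 < w ⬝ᵥ w := by
        have h4 : w ⬝ᵥ w ≠ 0 := fun h => hw.2 (dotProduct_self_eq_zero.mp h)
        have h5 : 0 ≤ w ⬝ᵥ w := Finset.sum_nonneg fun k _ => mul_self_nonneg _
        exact lt_of_le_of_ne h5 h4.symm
      exact le_of_mul_le_mul_right h2 h3
  have hs : smallestEigenvalue M = lam k₀ := hleast.csInf_eq
  rw [hs]
  exact ⟨hlow, _, hunit, hval⟩

end SmallestEigenvalue

/-! ### Best approximation of a two-row array by one of rank at most one. -/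

section LowRankApproximation

variable {ι : Type*} [Fintype ι]

/-- The Gram matrix of two vectors. -/
def gramTwo (x y : ι → ℝ) : Matrix (Fin 2) (Fin 2) ℝ :=
  ∑ k, Matrix.vecMulVec ![x k, y k] ![x k, y k]

theorem gramTwo_isSymm (x y : ι → ℝ) : (gramTwo x y).IsSymm := by
  rw [Matrix.IsSymm, gramTwo, Matrix.transpose_sum]
  exact Finset.sum_congr rfl fun k _ => Matrix.transpose_vecMulVec _ _

theorem dotProduct_gramTwo_mulVec (x y : ι → ℝ) (w : Fin 2 → ℝ) :
    w ⬝ᵥ gramTwo x y *ᵥ w = ∑ k, (w 0 * x k + w 1 * y k) ^ 2 := by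
  rw [gramTwo, Matrix.sum_mulVec, dotProduct_sum]
  refine Finset.sum_congr rfl fun k _ => ?_
  rw [Matrix.vecMulVec_mulVec]
  simp [dotProduct, Fin.sum_univ_two]
  ring

/-- An approximant of rank at most one is annihilated from the left by some unit vector `(c, d)`.
The Rayleigh quotient there only sees the error, and Cauchy–Schwarz bounds it columnwise. -/
theorem smallestEigenvalue_gramTwo_le (x y x' y' : ι → ℝ) (h : ∀ k l, x' k * y' l = x' l * y' k) :
    smallestEigenvalue (gramTwo x y) ≤ ∑ k, ((x k - x' k) ^ 2 + (y k - y' k) ^ 2) := by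
  obtain ⟨a, b, u, hu⟩ := exists_eq_mul_of_minors_eq_zero h
  obtain ⟨c, d, hcd, h0⟩ : ∃ c d : ℝ, c ^ 2 + d ^ 2 = 1 ∧ c * a + d * b = 0 := by
    by_cases hab : a = 0 ∧ b = 0
    · exact ⟨1, 0, by norm_num, by rw [hab.1, hab.2]; ring⟩
    · have hpos : 0 < a ^ 2 + b ^ 2 := by
        rcases not_and_or.mp hab with h | h <;> positivity
      -- The unit vector orthogonal to `(a, b)`.
      refine ⟨b / √(a ^ 2 + b ^ 2), -a / √(a ^ 2 + b ^ 2), ?_, by ring⟩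
      rw [div_pow, div_pow, Real.sq_sqrt hpos.le]
      field_simp
      ring
  have h1 := (smallestEigenvalue_isLeast_rayleigh (gramTwo_isSymm x y)).1 ![c, d]
  have h2 : (![c, d] : Fin 2 → ℝ) ⬝ᵥ ![c, d] = 1 := by
    simp [dotProduct, Fin.sum_univ_two]
    linarith
  rw [h2, mul_one, dotProduct_gramTwo_mulVec] at h1
  refine h1.trans (Finset.sum_le_sum fun k _ => ?_)
  simp only [Matrix.cons_val_zero, Matrix.cons_val_one]
  have h3 : c * x k + d * y k = c * (x k - x' k) + d * (y k - y' k) := by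
    rw [(hu k).1, (hu k).2]
    linear_combination (u k) * h0
  rw [h3]
  have h4 : (x k - x' k) ^ 2 + (y k - y' k) ^ 2
      = (c ^ 2 + d ^ 2) * ((x k - x' k) ^ 2 + (y k - y' k) ^ 2) := by rw [hcd, one_mul]
  rw [h4]
  nlinarith [sq_nonneg (c * (y k - y' k) - d * (x k - x' k))]

/-- Remove from each column its component along a unit minimizer `w` of the Rayleigh quotient. All
remaining columns are orthogonal to `w` in the plane, hence parallel, and the squared error is the
Rayleigh quotient at `w`. -/
theorem exists_minors_eq_zero_sum_eq_smallestEigenvalue (x y : ι → ℝ) :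
    ∃ x' y' : ι → ℝ, (∀ k l, x' k * y' l = x' l * y' k) ∧
      ∑ k, ((x k - x' k) ^ 2 + (y k - y' k) ^ 2) = smallestEigenvalue (gramTwo x y) := by
  obtain ⟨w, hw, hwM⟩ := (smallestEigenvalue_isLeast_rayleigh (gramTwo_isSymm x y)).2
  rw [dotProduct_gramTwo_mulVec] at hwM
  have hw' : w 0 * w 0 + w 1 * w 1 = 1 := by
    simpa [dotProduct, Fin.sum_univ_two] using hw
  refine ⟨fun k => x k - w 0 * (w 0 * x k + w 1 * y k),
    fun k => y k - w 1 * (w 0 * x k + w 1 * y k), fun k l => ?_, ?_⟩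
  · linear_combination (x l * y k - x k * y l) * hw'
  · rw [← hwM]
    refine Finset.sum_congr rfl fun k _ => ?_
    linear_combination (w 0 * x k + w 1 * y k) ^ 2 * hw'

end LowRankApproximation

/-! ### The sparse Cholesky factor. -/

section LowerTriangular

variable {m : ℕ} {i j : Fin m}

/-- The diagonal matrix `d` with an additional entry `f` at position `j i`. -/
def transvecDiagonal (i j : Fin m) (d : Fin m → ℝ) (f : ℝ) : Matrix (Fin m) (Fin m) ℝ :=
  Matrix.diagonal d + Matrix.single j i f

theorem transvecDiagonal_mul_apply (d : Fin m → ℝ) (f : ℝ) (X : Matrix (Fin m) (Fin m) ℝ)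
    (a b : Fin m) : (transvecDiagonal i j d f * X) a b
      = d a * X a b + if a = j then f * X i b else 0 := by
  rw [transvecDiagonal, Matrix.add_mul, Matrix.add_apply, Matrix.diagonal_mul]
  by_cases h : a = j
  · subst h; simp
  · simp [h, Matrix.single_mul_apply_of_ne]

theorem mul_transvecDiagonal_transpose_apply (d : Fin m → ℝ) (f : ℝ)
    (X : Matrix (Fin m) (Fin m) ℝ) (a b : Fin m) :
    (X * (transvecDiagonal i j d f)ᵀ) a b = d b * X a b + if b = j then f * X a i else 0 := by
  have := transvecDiagonal_mul_apply (i := i) (j := j) d f Xᵀ b a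
  rw [← Matrix.transpose_transpose X, ← Matrix.transpose_mul, Matrix.transpose_apply, this]
  rfl

theorem congr_transvecDiagonal_apply (d : Fin m → ℝ) (f : ℝ)
    (X : Matrix (Fin m) (Fin m) ℝ) (a b : Fin m) :
    (transvecDiagonal i j d f * X * (transvecDiagonal i j d f)ᵀ) a b =
      d b * (d a * X a b + if a = j then f * X i b else 0) +
        if b = j then f * (d a * X a i + if a = j then f * X i i else 0) else 0 := by
  rw [mul_transvecDiagonal_transpose_apply, transvecDiagonal_mul_apply, transvecDiagonal_mul_apply]

/-- A positive definite matrix whose only nonzero off-diagonal entries are at `i j` and `j i` has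
a Cholesky factor of the same shape. -/
theorem exists_transvecDiagonal_mul_transpose {S : Matrix (Fin m) (Fin m) ℝ} (hS : S.PosDef)
    (hij : i ≠ j) (h0 : ∀ a b, a ≠ b → b ≠ i → b ≠ j → S a b = 0) :
    ∃ (d d' : Fin m → ℝ) (f f' : ℝ), (∀ k, d k ≠ 0) ∧
      transvecDiagonal i j d f * transvecDiagonal i j d' f' = 1 ∧
      transvecDiagonal i j d f * S * (transvecDiagonal i j d f)ᵀ = 1 := by
  have hsymm : S.IsSymm := hS.isHermitian
  have hd : ∀ a, 0 < S a a := fun a => hS.diag_pos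
  -- This Schur complement is the value of the quadratic form at `e_j - (S_ij / S_ii) e_i`.
  have hr : 0 < S j j - S i j ^ 2 / S i i := by
    have hne : (Pi.single j 1 - Pi.single i (S i j / S i i) : Fin m → ℝ) ≠ 0 := by
      intro h
      have := congrFun h j
      simp [hij.symm] at this
    have := hS.dotProduct_mulVec_pos hne
    simp only [star_trivial] at this
    rw [Matrix.mulVec_sub, Matrix.mulVec_single_one, sub_dotProduct, dotProduct_sub,
      dotProduct_sub, Matrix.mulVec_single] at this
    simp at this
    rw [hsymm.apply i j] at this
    have h1 := (hd i).ne'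
    have h2 : S j j - S i j ^ 2 / S i i = S j j - S i j * (S i j * (S i i)⁻¹)
        - (S i j / S i i * S i j - S i j / S i i * S i i * (S i j * (S i i)⁻¹)) := by
      field_simp; ring
    rw [h2]
    linarith
  set r := S j j - S i j ^ 2 / S i i with hrdef
  let d : Fin m → ℝ := fun k => if k = j then (√r)⁻¹ else (√(S k k))⁻¹
  have hdpos : ∀ k, 0 < d k := by
    intro k
    simp only [d]
    split_ifs
    · exact inv_pos.mpr (Real.sqrt_pos.mpr hr)
    · exact inv_pos.mpr (Real.sqrt_pos.mpr (hd k))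
  have hdj : d j * d j * r = 1 := by
    simp only [d, if_true]
    rw [← mul_inv, Real.mul_self_sqrt hr.le, inv_mul_cancel₀ hr.ne']
  have hdk : ∀ k, k ≠ j → d k * d k * S k k = 1 := by
    intro k hk
    simp only [d, if_neg hk]
    rw [← mul_inv, Real.mul_self_sqrt (hd k).le, inv_mul_cancel₀ (hd k).ne']
  have hSz : ∀ a b, a ≠ b → a ≠ j → b ≠ j → S a b = 0 := by
    intro a b hab ha hb
    rcases eq_or_ne b i with rfl | hbi
    · rw [← hsymm.apply a b]; exact h0 b a hab.symm hab ha
    · exact h0 a b hab hbi hb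
  -- The entry at `j i` performs one elimination step: it subtracts `S_ij / S_ii` times row `i` from
  -- row `j` before row `j` is scaled by `d j`. The inverse has the same shape.
  refine ⟨d, fun k => (d k)⁻¹, -(S i j / S i i) * d j, S i j / S i i / d i,
    fun k => (hdpos k).ne', ?_, ?_⟩
  · ext a b
    rw [transvecDiagonal_mul_apply]
    simp only [transvecDiagonal, Matrix.add_apply, Matrix.diagonal_apply, Matrix.single_apply,
      Matrix.one_apply]
    have h1 := (hdpos a).ne'
    have h2 := (hdpos i).ne'
    have h3 := (hd i).ne'
    by_cases haj : a = j
    · subst haj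
      by_cases hab : a = b
      · subst hab; simp [hij, hij.symm, h1]
      · by_cases hib : i = b
        · subst hib; simp [hij.symm]; field_simp; ring
        · simp [hab, hib]
    · by_cases hab : a = b
      · subst hab; simp [haj, Ne.symm haj, h1]
      · simp [hab, haj, Ne.symm haj]
  · ext a b
    rw [congr_transvecDiagonal_apply, Matrix.one_apply]
    have h3 := (hd i).ne'
    by_cases haj : a = j
    · subst haj
      by_cases hba : b = a
      · subst hba
        simp only [if_true]
        rw [← hdj, hrdef, hsymm.apply i b]
        field_simp
        ring
      · simp only [if_true, if_neg hba, if_neg (Ne.symm hba)]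
        by_cases hbi : b = i
        · subst hbi
          rw [hsymm.apply b a]
          field_simp
          ring
        · rw [h0 a b (Ne.symm hba) hbi hba, h0 i b (Ne.symm hbi) hbi hba]
          ring
    · by_cases hbj : b = j
      · subst hbj
        simp only [if_true, if_neg haj]
        by_cases hai : a = i
        · subst hai
          field_simp
          ring
        · rw [← hsymm.apply a b, h0 b a (Ne.symm haj) hai haj, hSz a i hai haj hij]
          ring
      · simp only [if_neg haj, if_neg hbj]
        by_cases hab : a = b
        · subst hab
          rw [if_pos rfl, ← hdk a haj]
          ring
        · rw [if_neg hab, hSz a b hab haj hbj]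
          ring

end LowerTriangular

/-! ### Whitened coordinates, in which the Fisher metric is Euclidean. -/

section SymSums

variable {m : ℕ}

/-- The double sum meets each off-diagonal entry twice and each diagonal entry once; the resulting
weights are the squares of `frobWeight`. -/
theorem sum_sum_eq_sum_symIdx {F : Fin m → Fin m → ℝ} (hF : ∀ a b, F a b = F b a) :
    (∑ a, ∑ b, F a b) / 2 =
      ∑ p : SymIdx m, (if p.1.1 = p.1.2 then 1 / 2 else 1) * F p.1.1 p.1.2 := by
  have h1 : ∑ p : SymIdx m, (if p.1.1 = p.1.2 then 1 / 2 else 1) * F p.1.1 p.1.2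
      = ∑ q : Fin m × Fin m, if q.1 ≤ q.2 then (if q.1 = q.2 then 1 / 2 else 1) * F q.1 q.2
        else 0 := by
    rw [← Finset.sum_filter]
    exact (Finset.sum_subtype _ (by simp)
      (fun q : Fin m × Fin m => (if q.1 = q.2 then 1 / 2 else 1) * F q.1 q.2)).symm
  have h2 : ∑ q : Fin m × Fin m, (if q.1 ≤ q.2 then (if q.1 = q.2 then 1 / 2 else 1) * F q.1 q.2
        else 0) = ∑ q : Fin m × Fin m,
          if q.2 ≤ q.1 then (if q.1 = q.2 then 1 / 2 else 1) * F q.1 q.2 else 0 := by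
    rw [← Equiv.sum_comp (Equiv.prodComm (Fin m) (Fin m))]
    refine Finset.sum_congr rfl fun q _ => ?_
    simp only [Equiv.prodComm_apply, Prod.fst_swap, Prod.snd_swap, hF q.2 q.1, eq_comm]
  have h3 : ∑ a, ∑ b, F a b = ∑ q : Fin m × Fin m, F q.1 q.2 :=
    (Fintype.sum_prod_type fun q : Fin m × Fin m => F q.1 q.2).symm
  have h4 : ∑ q : Fin m × Fin m, F q.1 q.2
      = ∑ q : Fin m × Fin m, (if q.1 ≤ q.2 then (if q.1 = q.2 then 1 / 2 else 1) * F q.1 q.2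
        else 0) + ∑ q : Fin m × Fin m,
          if q.2 ≤ q.1 then (if q.1 = q.2 then 1 / 2 else 1) * F q.1 q.2 else 0 := by
    rw [← Finset.sum_add_distrib]
    refine Finset.sum_congr rfl fun q _ => ?_
    rcases lt_trichotomy q.1 q.2 with h | h | h
    · simp [h.le, h.ne, not_le.mpr h]
    · simp [h]; ring
    · simp [h.le, h.ne', not_le.mpr h]
  rw [h1, h3, h4, ← h2]
  ring

end SymSums

section Whitening

variable {m : ℕ}

/-- The scaling of the upper triangular entries that makes half the squared Frobenius norm of a
symmetric matrix the squared Euclidean norm. -/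
noncomputable def frobWeight (p : SymIdx m) : ℝ := if p.1.1 = p.1.2 then (√2)⁻¹ else 1

theorem frobWeight_pos (p : SymIdx m) : 0 < frobWeight p := by
  unfold frobWeight
  split_ifs <;> positivity

theorem frobWeight_sq (p : SymIdx m) :
    frobWeight p ^ 2 = if p.1.1 = p.1.2 then 1 / 2 else 1 := by
  unfold frobWeight
  split_ifs
  · rw [inv_pow, Real.sq_sqrt (by norm_num)]; norm_num
  · norm_num

/-- The scaled upper triangular entries of `L X Lᵗ`, where `X` is the symmetric matrix with the
given coordinates. -/
noncomputable def whiten (L : Matrix (Fin m) (Fin m) ℝ) : (SymIdx m → ℝ) →ₗ[ℝ] (SymIdx m → ℝ) where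
  toFun v p := frobWeight p * symCoords (L * symMatrix v * Lᵀ) p
  map_add' v w := by
    funext p
    simp only [symMatrix_add, Matrix.mul_add, Matrix.add_mul, symCoords, Matrix.add_apply,
      Pi.add_apply]
    ring
  map_smul' c v := by
    funext p
    simp only [symMatrix_smul, Matrix.mul_smul, Matrix.smul_mul, symCoords, Matrix.smul_apply,
      Pi.smul_apply, RingHom.id_apply, smul_eq_mul]
    ring

theorem whiten_apply (L : Matrix (Fin m) (Fin m) ℝ) (v : SymIdx m → ℝ) (p : SymIdx m) :
    whiten L v p = frobWeight p * (L * symMatrix v * Lᵀ) p.1.1 p.1.2 := rfl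

theorem isSymm_congr (L : Matrix (Fin m) (Fin m) ℝ) {X : Matrix (Fin m) (Fin m) ℝ}
    (hX : X.IsSymm) : (L * X * Lᵀ).IsSymm := by
  rw [Matrix.IsSymm, Matrix.transpose_mul, Matrix.transpose_mul, hX.eq, Matrix.transpose_transpose,
    Matrix.mul_assoc]

theorem whiten_symIdx (L : Matrix (Fin m) (Fin m) ℝ) (v : SymIdx m → ℝ) {a b : Fin m}
    (hab : a ≠ b) : whiten L v (symIdx a b) = (L * symMatrix v * Lᵀ) a b := by
  have h1 : frobWeight (symIdx a b) = 1 := by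
    unfold frobWeight symIdx
    rw [if_neg]
    intro h
    rcases le_total a b with h' | h' <;> simp [h'] at h
    · exact hab h
    · exact hab h.symm
  change frobWeight (symIdx a b) * symCoords _ (symIdx a b) = _
  rw [h1, one_mul, symCoords_symIdx (isSymm_congr L (symMatrix_isSymm v))]

variable {S L M : Matrix (Fin m) (Fin m) ℝ}

theorem whiten_surjective (hLM : L * M = 1) : Function.Surjective (whiten L) := by
  intro y
  refine ⟨symCoords (M * symMatrix (fun p => (frobWeight p)⁻¹ * y p) * Mᵀ), ?_⟩
  funext p
  rw [whiten_apply, symMatrix_symCoords (isSymm_congr M (symMatrix_isSymm _))]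
  have h : L * (M * symMatrix (fun p => (frobWeight p)⁻¹ * y p) * Mᵀ) * Lᵀ
      = symMatrix (fun p => (frobWeight p)⁻¹ * y p) := by
    calc L * (M * symMatrix (fun p => (frobWeight p)⁻¹ * y p) * Mᵀ) * Lᵀ
        = (L * M) * symMatrix (fun p => (frobWeight p)⁻¹ * y p) * (Mᵀ * Lᵀ) := by
          simp only [Matrix.mul_assoc]
      _ = _ := by
          rw [← Matrix.transpose_mul, hLM, Matrix.one_mul, Matrix.transpose_one, Matrix.mul_one]
  rw [h, symMatrix_apply, symIdx_of_le p.2, mul_inv_cancel_left₀ (frobWeight_pos _).ne']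

theorem inv_eq_transpose_mul_of_whitening (hLM : L * M = 1) (hL : L * S * Lᵀ = 1) :
    S⁻¹ = Lᵀ * L := by
  have hML : M * L = 1 := mul_eq_one_comm.mp hLM
  refine inv_eq_transpose_mul_of_congr hLM ?_
  have hT : Lᵀ * Mᵀ = 1 := by rw [← Matrix.transpose_mul, hML, Matrix.transpose_one]
  calc M * Mᵀ = M * (L * S * Lᵀ) * Mᵀ := by rw [hL, Matrix.mul_one]
    _ = (M * L) * S * (Lᵀ * Mᵀ) := by simp only [Matrix.mul_assoc]
    _ = S := by rw [hML, hT, Matrix.one_mul, Matrix.mul_one]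

/-- Since `S⁻¹ = Lᵀ L`, cyclicity of the trace turns the Fisher form into half the squared Frobenius
norm of the symmetric matrix `L X Lᵀ`. -/
theorem dotProduct_fisherInformation_mulVec_eq_sum (hS : S.PosDef) (hLM : L * M = 1)
    (hL : L * S * Lᵀ = 1) (v : SymIdx m → ℝ) :
    v ⬝ᵥ fisherInformation S *ᵥ v = ∑ p, whiten L v p ^ 2 := by
  rw [dotProduct_fisherInformation_mulVec hS, inv_eq_transpose_mul_of_whitening hLM hL]
  set X := symMatrix v with hX
  have hY : (L * X * Lᵀ).IsSymm := isSymm_congr L (symMatrix_isSymm v)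
  have h1 : (Lᵀ * L * X * (Lᵀ * L * X)).trace = ((L * X * Lᵀ) * (L * X * Lᵀ)).trace := by
    rw [show Lᵀ * L * X * (Lᵀ * L * X) = Lᵀ * (L * X * Lᵀ * (L * X)) by
      simp only [Matrix.mul_assoc], Matrix.trace_mul_comm]
    simp only [Matrix.mul_assoc]
  have h2 : ((L * X * Lᵀ) * (L * X * Lᵀ)).trace = ∑ a, ∑ b, (L * X * Lᵀ) a b ^ 2 := by
    rw [Matrix.trace]
    refine Finset.sum_congr rfl fun a _ => ?_
    rw [Matrix.diag_apply, Matrix.mul_apply]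
    refine Finset.sum_congr rfl fun b _ => ?_
    rw [hY.apply a b, sq]
  rw [h1, h2, sum_sum_eq_sum_symIdx fun a b => by rw [hY.apply a b]]
  refine Finset.sum_congr rfl fun p _ => ?_
  rw [whiten_apply, mul_pow, frobWeight_sq]

theorem mahalanobisForm_fisherInformation (hS : S.PosDef) (hLM : L * M = 1)
    (hL : L * S * Lᵀ = 1) (z τ : SymIdx m → ℝ) :
    mahalanobisForm (fisherInformation S) z τ = ∑ p, (whiten L z p - whiten L τ p) ^ 2 := by
  rw [mahalanobisForm, dotProduct_fisherInformation_mulVec_eq_sum hS hLM hL]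
  simp only [map_sub, Pi.sub_apply]

/-- Polarization: both matrices are symmetric and have the same quadratic form. -/
theorem fisherInformation_eq_transpose_mul (hS : S.PosDef) (hLM : L * M = 1)
    (hL : L * S * Lᵀ = 1) :
    fisherInformation S = (LinearMap.toMatrix' (whiten L))ᵀ * LinearMap.toMatrix' (whiten L) := by
  set T := LinearMap.toMatrix' (whiten L) with hT
  have hTv : ∀ v, T *ᵥ v = whiten L v := fun v => by
    rw [hT, ← Matrix.toLin'_apply, Matrix.toLin'_toMatrix']
  have hquad : ∀ v, v ⬝ᵥ fisherInformation S *ᵥ v = v ⬝ᵥ (Tᵀ * T) *ᵥ v := by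
    intro v
    rw [dotProduct_fisherInformation_mulVec_eq_sum hS hLM hL, ← Matrix.mulVec_mulVec,
      Matrix.dotProduct_mulVec, Matrix.vecMul_transpose, hTv]
    simp only [dotProduct, sq]
  have hsI := fisherInformation_isSymm S
  have hsT : (Tᵀ * T).IsSymm := by
    rw [Matrix.IsSymm, Matrix.transpose_mul, Matrix.transpose_transpose]
  ext a b
  have key : ∀ {N : Matrix (SymIdx m) (SymIdx m) ℝ}, N.IsSymm →
      (Pi.single a 1 + Pi.single b 1) ⬝ᵥ N *ᵥ (Pi.single a 1 + Pi.single b 1)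
      = Pi.single a 1 ⬝ᵥ N *ᵥ Pi.single a 1 + Pi.single b 1 ⬝ᵥ N *ᵥ Pi.single b 1
        + 2 * N a b := by
    intro N hN
    simp only [Matrix.mulVec_add, dotProduct_add, add_dotProduct, Matrix.mulVec_single_one,
      single_one_dotProduct, Matrix.col_apply]
    rw [hN.apply a b]
    ring
  have h1 := key hsI
  have h2 := key hsT
  rw [hquad, hquad, hquad] at h1
  linarith

/-- Whitening turns a normal vector with the inverse Fisher information as covariance into a
standard normal vector. -/
theorem map_whiten_multivariateGaussian (hS : S.PosDef) (hLM : L * M = 1)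
    (hL : L * S * Lᵀ = 1) :
    (multivariateGaussian 0 (fisherInformation S)⁻¹).map (fun z => whiten L z.ofLp)
      = Measure.pi fun _ => gaussianReal 0 1 := by
  set T := LinearMap.toMatrix' (whiten L) with hT
  have hTv : ∀ v, T *ᵥ v = whiten L v := fun v => by
    rw [hT, ← Matrix.toLin'_apply, Matrix.toLin'_toMatrix']
  have hI := fisherInformation_eq_transpose_mul hS hLM hL
  rw [← hT] at hI
  obtain ⟨R, hR⟩ : ∃ R, T * R = 1 := by
    rw [← Matrix.mulVec_surjective_iff_exists_right_inverse]
    intro y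
    obtain ⟨v, hv⟩ := whiten_surjective hLM y
    exact ⟨v, (hTv v).trans hv⟩
  have hRT : R * T = 1 := mul_eq_one_comm.mp hR
  have hinv : (fisherInformation S)⁻¹ = R * Rᵀ := by
    apply Matrix.inv_eq_left_inv
    rw [hI, Matrix.mul_assoc, ← Matrix.mul_assoc Rᵀ, ← Matrix.transpose_mul, hR,
      Matrix.transpose_one, Matrix.one_mul, hRT]
  have hpsd : ((fisherInformation S)⁻¹).PosSemidef := by
    rw [hinv, ← Matrix.conjTranspose_eq_transpose_of_trivial]
    exact Matrix.posSemidef_self_mul_conjTranspose R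
  have hC : T * (fisherInformation S)⁻¹ * Tᵀ = 1 := by
    rw [hinv, ← Matrix.mul_assoc, hR, Matrix.one_mul, ← Matrix.transpose_mul, hR,
      Matrix.transpose_one]
  rw [← map_mulVec_multivariateGaussian hpsd hC]
  simp only [hTv]

end Whitening

/-! ### The cone in whitened coordinates and the distance to it. -/

section WhitenedCone

variable {m : ℕ} {i j : Fin m}

/-- Conjugation only rescales the entries outside rows and columns `i, j`. On the two-row block it
scales rows and columns and adds a multiple of row `i` to row `j`, so each minor is multiplied by
the nonzero `d_k d_l d_i d_j`. -/
theorem mem_algebraicTangentCone_iff_whiten {S : Matrix (Fin m) (Fin m) ℝ} (hS : S.IsSymm)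
    (hij : i ≠ j) (hs : S i j ≠ 0) (h0 : ∀ a b, a ≠ b → b ≠ i → b ≠ j → S a b = 0)
    {d : Fin m → ℝ} {f : ℝ} (hd : ∀ k, d k ≠ 0) (τ : SymIdx m → ℝ) :
    τ ∈ algebraicTangentCone (symCoords '' factorModel m 1) (symCoords S) ↔
      (∀ k l, k ≠ i → k ≠ j → l ≠ i → l ≠ j → k ≠ l →
        whiten (transvecDiagonal i j d f) τ (symIdx k l) = 0) ∧
      ∀ k l, k ≠ i → k ≠ j → l ≠ i → l ≠ j →
        whiten (transvecDiagonal i j d f) τ (symIdx i k) *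
          whiten (transvecDiagonal i j d f) τ (symIdx j l) =
        whiten (transvecDiagonal i j d f) τ (symIdx i l) *
          whiten (transvecDiagonal i j d f) τ (symIdx j k) := by
  rw [mem_algebraicTangentCone_iff hS hij hs h0]
  have hkl : ∀ k l, k ≠ j → l ≠ j → k ≠ l →
      whiten (transvecDiagonal i j d f) τ (symIdx k l) = d l * (d k * symMatrix τ k l) := by
    intro k l hkj hlj hkl
    rw [whiten_symIdx _ _ hkl, congr_transvecDiagonal_apply, if_neg hkj, if_neg hlj]
    ring
  have hjl : ∀ l, l ≠ j → whiten (transvecDiagonal i j d f) τ (symIdx j l)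
      = d l * (d j * symMatrix τ j l + f * symMatrix τ i l) := by
    intro l hlj
    rw [whiten_symIdx _ _ hlj.symm, congr_transvecDiagonal_apply, if_neg hlj, if_pos rfl]
    ring
  refine and_congr ?_ ?_
  · refine forall_congr' fun k => forall_congr' fun l => forall_congr' fun hki =>
      forall_congr' fun hkj => forall_congr' fun hli => forall_congr' fun hlj =>
      forall_congr' fun hne => ?_
    rw [hkl k l hkj hlj hne]
    simp [hd]
  · refine forall_congr' fun k => forall_congr' fun l => forall_congr' fun hki =>
      forall_congr' fun hkj => forall_congr' fun hli => forall_congr' fun hlj => ?_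
    rw [hkl i k hij hkj hki.symm, hkl i l hij hlj hli.symm, hjl k hkj, hjl l hlj,
      ← sub_eq_zero, ← sub_eq_zero (b := _ * (d k * _))]
    have h : d k * (d i * symMatrix τ i k) * (d l * (d j * symMatrix τ j l + f * symMatrix τ i l))
        - d l * (d i * symMatrix τ i l) * (d k * (d j * symMatrix τ j k + f * symMatrix τ i k))
        = d k * d l * d i * d j *
          (symMatrix τ i k * symMatrix τ j l - symMatrix τ i l * symMatrix τ j k) := by ring
    rw [h]
    simp [hd]

/-- The indices different from `i` and `j`. -/
abbrev Others (i j : Fin m) : Type := {k : Fin m // k ≠ i ∧ k ≠ j}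

/-- The coordinates constrained by the tangent cone: the off-diagonal entries outside the rows and
columns `i`, `j`, and the entries in rows `i` and `j` outside the columns `i`, `j`. -/
def coneIndex (i j : Fin m) :
    {p : Others i j × Others i j // p.1 < p.2} ⊕ (Others i j × Fin 2) → SymIdx m :=
  Sum.elim (fun p => symIdx p.1.1.1 p.1.2.1) fun q => symIdx (![i, j] q.2) q.1.1

theorem coneIndex_injective (hij : i ≠ j) : Function.Injective (coneIndex i j) := by
  have hc : ∀ (c : Fin 2) (k : Others i j), k.1 ≠ ![i, j] c := by
    intro c k
    fin_cases c
    · exact k.2.1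
    · exact k.2.2
  rintro (⟨⟨a, b⟩, hab⟩ | ⟨a, c⟩) (⟨⟨a', b'⟩, hab'⟩ | ⟨a', c'⟩) h
  · rcases symIdx_eq_iff.mp h with ⟨h1, h2⟩ | ⟨h1, h2⟩
    · simp only at h1 h2
      congr 3 <;> exact Subtype.ext ‹_›
    · exfalso
      have h3 : a = b' := Subtype.ext h1
      have h4 : b = a' := Subtype.ext h2
      rw [h3, h4] at hab
      exact lt_asymm hab hab'
  · rcases symIdx_eq_iff.mp h with ⟨h1, h2⟩ | ⟨h1, h2⟩
    · exact absurd h1 (hc _ _)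
    · exact absurd h2 (hc _ _)
  · rcases symIdx_eq_iff.mp h with ⟨h1, h2⟩ | ⟨h1, h2⟩
    · exact absurd h1.symm (hc _ _)
    · exact absurd h1.symm (hc _ _)
  · rcases symIdx_eq_iff.mp h with ⟨h1, h2⟩ | ⟨h1, h2⟩
    · have h2 : a = a' := Subtype.ext h2
      have hinj : c = c' := by
        fin_cases c <;> fin_cases c' <;> simp_all [Ne.symm hij]
      rw [h2, hinj]
    · exact absurd h1.symm (hc _ _)

/-- The whitened squared distance to the tangent cone. -/
noncomputable def coneDistSq (i j : Fin m) (y : SymIdx m → ℝ) : ℝ :=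
  ∑ p, y (coneIndex i j (Sum.inl p)) ^ 2 +
    smallestEigenvalue (gramTwo (fun k => y (coneIndex i j (Sum.inr (k, 0))))
      fun k => y (coneIndex i j (Sum.inr (k, 1))))

/-- The constraints involve only coordinates indexed by `coneIndex` and treat its two blocks
separately, so the minimum is the sum of the two block minima. -/
theorem isLeast_mahalanobisForm_algebraicTangentCone {S M : Matrix (Fin m) (Fin m) ℝ}
    (hS : S.PosDef) (hij : i ≠ j) (hs : S i j ≠ 0)
    (h0 : ∀ a b, a ≠ b → b ≠ i → b ≠ j → S a b = 0)
    {d : Fin m → ℝ} {f : ℝ} (hd : ∀ k, d k ≠ 0)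
    (hLM : transvecDiagonal i j d f * M = 1)
    (hL : transvecDiagonal i j d f * S * (transvecDiagonal i j d f)ᵀ = 1) (z : SymIdx m → ℝ) :
    IsLeast (mahalanobisForm (fisherInformation S) z ''
        algebraicTangentCone (symCoords '' factorModel m 1) (symCoords S))
      (coneDistSq i j (whiten (transvecDiagonal i j d f) z)) := by
  have hsymm : S.IsSymm := hS.isHermitian
  have hinj := coneIndex_injective hij
  set e := coneIndex i j with he
  have hmem := mem_algebraicTangentCone_iff_whiten hsymm hij hs h0 hd (f := f)
  set L := transvecDiagonal i j d f
  have hsplit : ∀ g : SymIdx m → ℝ, ∑ q, g (e q)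
      = ∑ p, g (e (Sum.inl p)) + ∑ k, (g (e (Sum.inr (k, 0))) + g (e (Sum.inr (k, 1)))) := by
    intro g
    rw [Fintype.sum_sum_type, Fintype.sum_prod_type]
    simp only [Fin.sum_univ_two]
  constructor
  · obtain ⟨x', y', hminor, hsum⟩ := exists_minors_eq_zero_sum_eq_smallestEigenvalue
      (fun k => whiten L z (e (Sum.inr (k, 0)))) (fun k => whiten L z (e (Sum.inr (k, 1))))
    -- The minimizer: zero on the first block, an optimal approximation of rank at most one on the
    -- second, and equal to the whitened `z` on all free coordinates.
    let η : SymIdx m → ℝ := Function.extend e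
      (Sum.elim (fun _ => 0) fun q => ![x' q.1, y' q.1] q.2) (whiten L z)
    obtain ⟨τ, hτ⟩ := whiten_surjective hLM η
    have hη : ∀ q, η (e q) = Sum.elim (fun _ => 0) (fun q => ![x' q.1, y' q.1] q.2) q :=
      fun q => hinj.extend_apply _ _ q
    refine ⟨τ, ?_, ?_⟩
    · rw [hmem, hτ]
      constructor
      · intro k l hki hkj hli hlj hkl
        rcases lt_or_gt_of_ne hkl with h | h
        · exact hη (Sum.inl ⟨(⟨k, hki, hkj⟩, ⟨l, hli, hlj⟩), h⟩)
        · rw [symIdx_comm]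
          exact hη (Sum.inl ⟨(⟨l, hli, hlj⟩, ⟨k, hki, hkj⟩), h⟩)
      · intro k l hki hkj hli hlj
        have hx : ∀ k : Others i j, η (symIdx i k.1) = x' k := fun k => hη (Sum.inr (k, 0))
        have hy : ∀ k : Others i j, η (symIdx j k.1) = y' k := fun k => hη (Sum.inr (k, 1))
        have := hminor ⟨k, hki, hkj⟩ ⟨l, hli, hlj⟩
        rwa [← hx, ← hx, ← hy, ← hy] at this
    · rw [mahalanobisForm_fisherInformation hS hLM hL, hτ, coneDistSq, ← he, ← hsum]
      rw [← Fintype.sum_of_injective e hinj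
        (fun q => (whiten L z (e q) - η (e q)) ^ 2) _ ?_ fun q => rfl,
        hsplit fun q => (whiten L z q - η q) ^ 2]
      · simp only [hη]
        simp
      · intro q hq
        have : η q = whiten L z q := Function.extend_apply' _ _ _ (by simpa using hq)
        rw [this]
        ring
  · rintro _ ⟨τ, hτ, rfl⟩
    rw [hmem] at hτ
    rw [mahalanobisForm_fisherInformation hS hLM hL]
    have h1 : ∑ q, (whiten L z (e q) - whiten L τ (e q)) ^ 2
        ≤ ∑ p, (whiten L z p - whiten L τ p) ^ 2 := by
      rw [← Finset.sum_image (f := fun p => (whiten L z p - whiten L τ p) ^ 2) hinj.injOn]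
      exact Finset.sum_le_univ_sum_of_nonneg fun p => sq_nonneg _
    refine le_trans ?_ h1
    rw [hsplit fun q => (whiten L z q - whiten L τ q) ^ 2, coneDistSq, ← he]
    refine add_le_add (Finset.sum_le_sum fun p _ => ?_) ?_
    · have : whiten L τ (e (Sum.inl p)) = 0 :=
        hτ.1 _ _ p.1.1.2.1 p.1.1.2.2 p.1.2.2.1 p.1.2.2.2 fun h => p.2.ne (Subtype.ext h)
      rw [this, sub_zero]
    · exact smallestEigenvalue_gramTwo_le _ _ _ _
        fun k l => hτ.2 k l k.2.1 k.2.2 l.2.1 l.2.2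

end WhitenedCone

/-! ### Chi-square and Wishart laws from blocks of independent normals. -/

section ProductLaws

variable {ι κ : Type*} [Fintype ι] [Fintype κ]

theorem pi_map_comp_injective {E : Type*} [MeasurableSpace E] (ν : Measure E)
    [IsProbabilityMeasure ν] {φ : ι → κ} (hφ : Function.Injective φ) :
    (Measure.pi fun _ : κ => ν).map (fun y i => y (φ i)) = Measure.pi fun _ : ι => ν := by
  rw [← Measure.infinitePi_eq_pi, ← Measure.infinitePi_eq_pi]
  exact Measure.map_infinitePi_infinitePi_of_inj (P := fun _ : κ => ν) hφ

theorem indepFun_comp_inl_comp_inr_pi {E : Type*} [MeasurableSpace E] (ν : Measure E)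
    [IsProbabilityMeasure ν] :
    IndepFun (fun (y : ι ⊕ κ → E) i => y (Sum.inl i)) (fun (y : ι ⊕ κ → E) k => y (Sum.inr k))
      (Measure.pi fun _ => ν) := by
  rw [indepFun_iff_map_prod_eq_prod_map_map (Measurable.aemeasurable (by fun_prop))
      (Measurable.aemeasurable (by fun_prop)),
    pi_map_comp_injective ν Sum.inl_injective, pi_map_comp_injective ν Sum.inr_injective]
  exact (measurePreserving_sumPiEquivProdPi fun _ : ι ⊕ κ => ν).map_eq

theorem map_sum_sq_pi_gaussianReal {n : ℕ} (hn : Fintype.card ι = n) :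
    (Measure.pi fun _ : ι => gaussianReal 0 1).map (fun x => ∑ i, x i ^ 2) = chiSquareLaw n := by
  let e : Fin n ≃ ι := (Fintype.equivFinOfCardEq hn).symm
  rw [chiSquareLaw, ← pi_map_comp_injective (gaussianReal 0 1) e.injective,
    Measure.map_map (by fun_prop) (by fun_prop)]
  congr 1
  funext x
  exact (e.sum_comp fun i => x i ^ 2).symm

theorem measurable_gramTwo : Measurable fun g : ι × Fin 2 → ℝ =>
    gramTwo (fun k => g (k, 0)) fun k => g (k, 1) := by
  refine measurable_pi_lambda _ fun a => measurable_pi_lambda _ fun b => ?_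
  simp only [gramTwo, Matrix.sum_apply, Matrix.vecMulVec_apply]
  refine Finset.measurable_sum _ fun k _ => Measurable.mul ?_ ?_
  · fin_cases a
    · exact measurable_pi_apply _
    · exact measurable_pi_apply _
  · fin_cases b
    · exact measurable_pi_apply _
    · exact measurable_pi_apply _

theorem map_gramTwo_pi_gaussianReal {n : ℕ} (hn : Fintype.card ι = n) :
    (Measure.pi fun _ : ι × Fin 2 => gaussianReal 0 1).map
      (fun g => gramTwo (fun k => g (k, 0)) fun k => g (k, 1)) = wishartLaw 2 n 1 := by
  let e : Fin n ≃ ι := (Fintype.equivFinOfCardEq hn).symm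
  -- Currying the array of independent normals gives `n` independent standard normal vectors in the
  -- plane.
  have h1 : (Measure.pi fun _ : ι × Fin 2 => gaussianReal 0 1).map
      (fun g (k : Fin n) => WithLp.toLp 2 fun c => g (e k, c))
      = Measure.pi fun _ : Fin n => multivariateGaussian (0 : EuclideanSpace ℝ (Fin 2)) 1 := by
    rw [multivariateGaussian_zero_one, ← map_pi_eq_stdGaussian]
    have hinj : Function.Injective (fun q : Fin n × Fin 2 => (e q.1, q.2)) :=
      e.injective.prodMap Function.injective_id
    have hcurry := Measure.infinitePi_map_curry
      (fun (_ : Fin n) (_ : Fin 2) => gaussianReal 0 1)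
    simp only [Measure.infinitePi_eq_pi] at hcurry
    rw [← Measure.pi_map_pi (fun _ => by fun_prop), ← hcurry,
      ← pi_map_comp_injective (gaussianReal 0 1) hinj,
      Measure.map_map (by fun_prop) (by fun_prop), Measure.map_map (by fun_prop) (by fun_prop)]
    rfl
  have hm : Measurable fun x : Fin n → EuclideanSpace ℝ (Fin 2) =>
      ∑ k, Matrix.vecMulVec (x k).ofLp (x k).ofLp := by
    refine measurable_pi_lambda _ fun a => measurable_pi_lambda _ fun b => ?_
    simp only [Matrix.sum_apply, Matrix.vecMulVec_apply]
    fun_prop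
  rw [wishartLaw, ← h1, Measure.map_map hm (by fun_prop)]
  congr 1
  funext g
  simp only [Function.comp_apply, gramTwo]
  rw [← e.sum_comp]
  refine Finset.sum_congr rfl fun k _ => ?_
  have : ![g (e k, 0), g (e k, 1)] = fun c => g (e k, c) := by
    funext c
    fin_cases c <;> rfl
  rw [this]

end ProductLaws

/-! ### Degrees of freedom and assembly of the distribution. -/

theorem card_ordered_pairs (α : Type*) [Fintype α] [LinearOrder α] :
    Fintype.card {p : α × α // p.1 < p.2} = (Fintype.card α).choose 2 := by
  rw [← Sym2.card_subtype_not_diag]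
  refine Fintype.card_congr (Equiv.ofBijective
    (fun p => ⟨s(p.1.1, p.1.2), fun h => p.2.ne (Sym2.mk_isDiag_iff.mp h)⟩) ⟨?_, ?_⟩)
  · rintro ⟨⟨a, b⟩, h⟩ ⟨⟨a', b'⟩, h'⟩ heq
    rcases Sym2.eq_iff.mp (Subtype.ext_iff.mp heq) with ⟨h1, h2⟩ | ⟨h1, h2⟩
    · simp_all
    · simp only at h1 h2 h h'
      subst h1 h2
      exact absurd h (lt_asymm h')
  · rintro ⟨s, hs⟩
    induction s using Sym2.ind with
    | h a b =>
      rcases lt_trichotomy a b with h | h | h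
      · exact ⟨⟨(a, b), h⟩, rfl⟩
      · exact absurd (Sym2.mk_isDiag_iff.mpr h) hs
      · exact ⟨⟨(b, a), h⟩, Subtype.ext Sym2.eq_swap⟩

theorem card_others {m : ℕ} {i j : Fin m} (hij : i ≠ j) : Fintype.card (Others i j) = m - 2 := by
  have h : Fintype.card (Others i j) = (Finset.univ \ {i, j} : Finset (Fin m)).card := by
    rw [Fintype.card_subtype]
    congr 1
    ext k
    simp
  rw [h, Finset.card_sdiff_of_subset (Finset.subset_univ _), Finset.card_pair hij, Finset.card_univ,
    Fintype.card_fin]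

theorem posDef_of_mem_factorModel {m l : ℕ} {S : Matrix (Fin m) (Fin m) ℝ}
    (hS : S ∈ factorModel m l) : S.PosDef := by
  obtain ⟨δ, Γ, hδ, rfl⟩ := hS
  refine (Matrix.PosDef.diagonal hδ).add_posSemidef ?_
  exact Matrix.posSemidef_self_mul_conjTranspose Γ

/-- Gaussian coordinates in two disjoint blocks give independent chi-square and Wishart parts. -/
theorem identDistrib_sum_sq_add_smallestEigenvalue {ι κ : Type*} [Fintype ι] [Fintype κ] {n k : ℕ}
    (hι : Fintype.card ι = k) (hκ : Fintype.card κ = n)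
    {Ω : Type*} [MeasurableSpace Ω] {Q : Measure Ω} {V W : Ω → ℝ}
    (hV : HasLaw V (chiSquareLaw k) Q)
    (hW : IdentDistrib W smallestEigenvalue Q (wishartLaw 2 n 1))
    (hVW : IndepFun V W Q) :
    IdentDistrib (fun u : ι ⊕ (κ × Fin 2) → ℝ => ∑ p, u (Sum.inl p) ^ 2 +
      smallestEigenvalue (gramTwo (fun k => u (Sum.inr (k, 0))) fun k => u (Sum.inr (k, 1))))
      (fun ω => V ω + W ω) (Measure.pi fun _ => gaussianReal 0 1) Q := by
  set ρ : Measure (ι ⊕ (κ × Fin 2) → ℝ) := Measure.pi fun _ => gaussianReal 0 1 with hρ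
  have hA : Measurable fun (u : ι ⊕ (κ × Fin 2) → ℝ) p => u (Sum.inl p) := by fun_prop
  have hB : Measurable fun (u : ι ⊕ (κ × Fin 2) → ℝ) q => u (Sum.inr q) := by fun_prop
  have hAB := indepFun_comp_inl_comp_inr_pi (ι := ι) (κ := κ × Fin 2) (gaussianReal 0 1)
  rw [← hρ] at hAB
  have hsq : Measurable fun x : ι → ℝ => ∑ p, x p ^ 2 := by fun_prop
  have hGB : Measurable fun u : ι ⊕ (κ × Fin 2) → ℝ =>
      gramTwo (fun k => u (Sum.inr (k, 0))) fun k => u (Sum.inr (k, 1)) :=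
    measurable_gramTwo.comp hB
  have hGlaw : ρ.map (fun u =>
      gramTwo (fun k => u (Sum.inr (k, 0))) fun k => u (Sum.inr (k, 1))) = wishartLaw 2 n 1 := by
    rw [← map_gramTwo_pi_gaussianReal hκ,
      ← pi_map_comp_injective (gaussianReal 0 1) (Sum.inr_injective (α := ι) (β := κ × Fin 2)),
      Measure.map_map measurable_gramTwo hB]
    rfl
  -- Almost everywhere measurability under the Wishart law is part of `hW`; it transfers because the
  -- Gram matrix has that law.
  have hsmall : AEMeasurable smallestEigenvalue (ρ.map (fun u =>
      gramTwo (fun k => u (Sum.inr (k, 0))) fun k => u (Sum.inr (k, 1)))) := by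
    rw [hGlaw]
    exact hW.aemeasurable_snd
  have hVident : IdentDistrib (fun u : ι ⊕ (κ × Fin 2) → ℝ => ∑ p, u (Sum.inl p) ^ 2) V ρ Q := by
    refine ⟨(hsq.comp hA).aemeasurable, hV.aemeasurable, ?_⟩
    rw [hV.map_eq, ← map_sum_sq_pi_gaussianReal hι,
      ← pi_map_comp_injective (gaussianReal 0 1) (Sum.inl_injective (α := ι) (β := κ × Fin 2)),
      Measure.map_map hsq hA]
    rfl
  have hWident : IdentDistrib (fun u : ι ⊕ (κ × Fin 2) → ℝ =>
      smallestEigenvalue (gramTwo (fun k => u (Sum.inr (k, 0))) fun k => u (Sum.inr (k, 1))))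
      W ρ Q := by
    refine ⟨hsmall.comp_measurable hGB, hW.aemeasurable_fst, ?_⟩
    rw [hW.map_eq, ← hGlaw, AEMeasurable.map_map_of_aemeasurable hsmall hGB.aemeasurable]
    rfl
  have hind : IndepFun (fun u : ι ⊕ (κ × Fin 2) → ℝ => ∑ p, u (Sum.inl p) ^ 2)
      (fun u : ι ⊕ (κ × Fin 2) → ℝ =>
        smallestEigenvalue (gramTwo (fun k => u (Sum.inr (k, 0))) fun k => u (Sum.inr (k, 1))))
      ρ := by
    refine (hAB.comp hsq measurable_gramTwo).comp₀ (φ := id) (ψ := smallestEigenvalue)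
      (hsq.comp hA).aemeasurable hGB.aemeasurable aemeasurable_id hsmall
  exact (hVident.prodMk hWident hind hVW).comp (u := fun q : ℝ × ℝ => q.1 + q.2) (by fun_prop)

/-- For a standard normal vector, the whitened squared distance to the tangent cone is the
independent sum of a chi-square variable and the smaller eigenvalue of a Wishart matrix. -/
theorem identDistrib_coneDistSq {m : ℕ} {i j : Fin m} (hij : i ≠ j)
    {Ω : Type*} [MeasurableSpace Ω] {P : Measure Ω}
    {Y : Ω → SymIdx m → ℝ} (hY : HasLaw Y (Measure.pi fun _ => gaussianReal 0 1) P)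
    {Ω' : Type*} [MeasurableSpace Ω'] {Q : Measure Ω'} {V W : Ω' → ℝ}
    (hV : HasLaw V (chiSquareLaw ((m - 2).choose 2)) Q)
    (hW : IdentDistrib W smallestEigenvalue Q (wishartLaw 2 (m - 2) 1))
    (hVW : IndepFun V W Q) :
    IdentDistrib (fun ω => coneDistSq i j (Y ω)) (fun ω => V ω + W ω) P Q := by
  have hcard : Fintype.card {p : Others i j × Others i j // p.1 < p.2} = (m - 2).choose 2 := by
    rw [card_ordered_pairs, card_others hij]
  have h := identDistrib_sum_sq_add_smallestEigenvalue hcard (card_others hij) hV hW hVW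
  have hU : HasLaw (fun ω q => Y ω (coneIndex i j q)) (Measure.pi fun _ => gaussianReal 0 1) P :=
    HasLaw.fun_comp (Y := fun (y : SymIdx m → ℝ) q => y (coneIndex i j q))
      ⟨Measurable.aemeasurable (by fun_prop), pi_map_comp_injective _ (coneIndex_injective hij)⟩ hY
  have hid : IdentDistrib (fun ω q => Y ω (coneIndex i j q)) id P
      (Measure.pi fun _ => gaussianReal 0 1) :=
    ⟨hU.aemeasurable, aemeasurable_id, by rw [hU.map_eq, Measure.map_id]⟩
  refine IdentDistrib.trans ?_ h
  exact hid.comp_of_aemeasurable (by rw [hU.map_eq]; exact h.aemeasurable_fst)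

theorem theorem6p3 (m : ℕ) (hm : 4 ≤ m)
    (S₀ : Matrix (Fin m) (Fin m) ℝ) (hS₀ : S₀ ∈ factorModel m 1)
    (hone : ∃! p : Fin m × Fin m, p.1 < p.2 ∧ S₀ p.1 p.2 ≠ 0)
    {Ω : Type*} [MeasurableSpace Ω] (P : Measure Ω) [IsProbabilityMeasure P]
    (Z : Ω → EuclideanSpace ℝ (SymIdx m))
    (hZ : HasLaw Z (multivariateGaussian 0 (fisherInformation S₀)⁻¹) P)
    {Ω' : Type*} [MeasurableSpace Ω'] (Q : Measure Ω') [IsProbabilityMeasure Q]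
    (V W : Ω' → ℝ)
    (hV : HasLaw V (chiSquareLaw ((m - 2).choose 2)) Q)
    (hW : IdentDistrib W smallestEigenvalue Q (wishartLaw 2 (m - 2) 1))
    (hVW : IndepFun V W Q) :
    (∀ z : SymIdx m → ℝ,
      IsLeast
        (mahalanobisForm (fisherInformation S₀) z ''
          algebraicTangentCone (symCoords '' factorModel m 1) (symCoords S₀))
        (mahalanobisDistSq (fisherInformation S₀)
          (algebraicTangentCone (symCoords '' factorModel m 1) (symCoords S₀)) z)) ∧
    IdentDistrib
      (fun ω => mahalanobisDistSq (fisherInformation S₀)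
        (algebraicTangentCone (symCoords '' factorModel m 1) (symCoords S₀)) (Z ω).ofLp)
      (fun ω => V ω + W ω) P Q := by
  obtain ⟨⟨i, j⟩, ⟨hlt, hs⟩, huniq⟩ := hone
  simp only at hlt hs
  have hij : i ≠ j := hlt.ne
  have hpd := posDef_of_mem_factorModel hS₀
  have hsymm := isSymm_of_mem_factorModel hS₀
  -- Uniqueness concerns pairs above the diagonal; symmetry extends the vanishing to both triangles.
  have h0 : ∀ a b, a ≠ b → b ≠ i → b ≠ j → S₀ a b = 0 := by
    intro a b hab hbi hbj
    by_contra hne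
    rcases lt_or_gt_of_ne hab with h | h
    · exact hbj (congrArg Prod.snd (huniq (a, b) ⟨h, hne⟩))
    · exact hbi (congrArg Prod.fst (huniq (b, a) ⟨h, by rwa [hsymm.apply a b]⟩))
  obtain ⟨d, d', f, f', hd, hLM, hL⟩ := exists_transvecDiagonal_mul_transpose hpd hij h0
  have hleast := isLeast_mahalanobisForm_algebraicTangentCone hpd hij hs h0 hd hLM hL
  have hdist : ∀ z, mahalanobisDistSq (fisherInformation S₀)
      (algebraicTangentCone (symCoords '' factorModel m 1) (symCoords S₀)) z
      = coneDistSq i j (whiten (transvecDiagonal i j d f) z) := fun z => (hleast z).csInf_eq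
  simp only [hdist]
  refine ⟨hleast, identDistrib_coneDistSq hij ?_ hV hW hVW⟩
  have hmeas : Measurable fun z : EuclideanSpace ℝ (SymIdx m) =>
      whiten (transvecDiagonal i j d f) z.ofLp :=
    ((LinearMap.continuous_of_finiteDimensional (whiten (transvecDiagonal i j d f))).comp
      (PiLp.continuous_ofLp 2 _)).measurable
  exact HasLaw.fun_comp (Y := fun z : EuclideanSpace ℝ (SymIdx m) =>
      whiten (transvecDiagonal i j d f) z.ofLp)
    ⟨hmeas.aemeasurable, map_whiten_multivariateGaussian hpd hLM hL⟩ hZ
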